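/- Setting. Let $d,K,T,B_1,B_2\ge 1$ be integers, $\delta,\rho>0$, $\alpha>1$, $L\ge 0$, $x_1\in\mathbb R^d$, and let $f:\mathbb R^d\times\mathcal Z\to\mathbb R$ be such that $f(\cdot,z)$ is $L$-Lipschitz (Euclidean norm) for every $z\in\mathcal Z$. A dataset consists of $M=K(B_1+B_2(T-1))$ points of $\mathcal Z$; its $M$ positions are partitioned (in a fixed way) into batches $Z_t^k$, $k\in[K]$, $t\in[T]$, of size $B_1$ if $t=1$ and $B_2$ if $t\ge2$. For a batch $z_{1:b}$ and independent uniformly random unit vectors $u_{ij}$ ($i\in[b]$, $j\in[d]$) put $$\mathrm{Grad}(x,z_{1:b})=\frac1b\sum_{i=1}^b\frac1d\sum_{j=1}^d\frac{d}{2\delta}\bigl(f(x+\delta u_{ij},z_i)-f(x-\delta u_{ij},z_i)\bigr)u_{ij},$$ $$\mathrm{Diff}(x,y,z_{1:b})=\frac1b\sum_{i=1}^b\frac1d\sum_{j=1}^d\frac{d}{\delta}\bigl(f(x+\delta u_{ij},z_i)-f(y+\delta u_{ij},z_i)\bigr)u_{ij}.$$ For $t\ge1$ let $\mathrm{Node}(t)$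 be the set of intervals produced by: start with $k=0$; for $e=\lceil\log_2 t\rceil,\dots,1,0$, if $k+2^e\le t$, add $(k+1,k+2^e)$ to the set and replace $k$ by $k+2^e$. Algorithm. Let $\mathcal A$ be a (possibly randomized) online algorithm: in round $t$ it outputs a vector in $\mathbb R^d$ which is a measurable function of its random seed and of the linear losses received in rounds $1,\dots,t-1$; assume that its domain is bounded by $D=\delta/T$, i.e. all its outputs have norm at most $\delta/T$. Start at $x_1^1=x_1$. For $k=1,\dots,K$, restart $\mathcal A$ with fresh randomness, draw independent $\xi_t^k\sim N(0,\sigma_t^2I)$, $t\in[T]$, and for $t=1,\dots,T$: receive $\Delta_t^k$ from $\mathcal A$; set $w_t^k=x_t^k+s_t^k\Delta_t^k$ with $s_t^k\sim\mathrm{Uniform}[0,1]$, and $x_{t+1}^k=x_t^k+\Delta_t^k$; set $g_1^k=\mathrm{Grad}(w_1^k,Z_1^k)$ if $t=1$ and $g_t^k=g_{t-1}^k+\mathrm{Diff}(w_t^k,w_{t-1}^k,Z_t^k)$ if $t\ge2$; send the loss vector $\tilde g_t^k=g_t^k+\sum_{(a,b)\in\mathrm{Node}(t)}\xi_b^k$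 to $\mathcal A$. After round $T$ set $\overline w^k=\frac1T\sum_{t=1}^Tw_t^k$ and $x_1^{k+1}=x_{T+1}^k$. The output is $\overline w$, chosen uniformly from $\overline w^1,\dots,\overline w^K$. All random draws are independent. Claim. Suppose $B_1\ge TB_2/2$ and, for all $t\in[T]$, $$\sigma_t=\sigma:=\sqrt{2\ln T}\,\frac{4dL}{B_2T\rho}.$$ Then the algorithm, as a randomized map from datasets to its output $\overline w\in\mathbb R^d$, is $(\alpha,\alpha\rho^2/2)$-Rényi differentially private: for any two datasets $Z,Z'$ that differ in at most one data point, the output laws $P_Z,P_{Z'}$ are probability measures with $D_\alpha(P_Z\|P_{Z'})\le\alpha\rho^2/2$, where $D_\alpha(\mu\|\nu)=\frac1{\alpha-1}\ln\int(d\mu/d\nu)^\alpha\,d\nu$ if $\mu\ll\nu$ and $+\infty$ otherwise. -/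

import Mathlib

open MeasureTheory ProbabilityTheory
open scoped NNReal ENNReal

noncomputable section

namespace PrivateO2NC

/-! ### Renyi differential privacy -/

/-- The Renyi divergence of order `α` (meant for `α > 1`), with values in `[-∞, ∞]`:
`(α - 1)⁻¹ * log ∫ (dμ/dν)^α dν` if `μ ≪ ν`, and `∞` otherwise. -/
def renyiDiv {R : Type*} [MeasurableSpace R] (α : ℝ) (μ ν : Measure R) : EReal :=
  open Classical in
  if μ ≪ ν then
    (((α - 1)⁻¹ : ℝ) : EReal) * ENNReal.log (∫⁻ x, (μ.rnDeriv ν x) ^ α ∂ν)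
  else ⊤

/-- Two datasets of the same size are neighboring if they differ in at most one data point. -/
def Neighboring {M : ℕ} {Z : Type*} (D D' : Fin M → Z) : Prop :=
  ∃ q, ∀ i, i ≠ q → D i = D' i

/-- `(α, ε)`-RDP of a randomized algorithm; `A D` is the law of its output on the dataset `D`. -/
def IsRDP {M : ℕ} {Z R : Type*} [MeasurableSpace R] (α ε : ℝ)
    (A : (Fin M → Z) → Measure R) : Prop :=
  ∀ D D', Neighboring D D' → renyiDiv α (A D) (A D') ≤ (ε : EReal)

/-! ### Zeroth-order estimators -/

/-- The Euclidean space of dimension `d`. -/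
abbrev E (d : ℕ) : Type := EuclideanSpace ℝ (Fin d)

/-- The unit sphere of `E d`. -/
abbrev Sph (d : ℕ) : Type := Metric.sphere (0 : E d) 1

/-- The uniform distribution on the unit sphere: the normalized surface measure. -/
def unifSphere (d : ℕ) : Measure (Sph d) :=
  ((volume : Measure (E d)).toSphere Set.univ)⁻¹ • (volume : Measure (E d)).toSphere

/-- Zeroth-order gradient estimator on a batch `z` of size `b`, with `d` directions `u i j` for
each data point `z i`. -/
def gradEst {d b : ℕ} {Z : Type*} (f : E d → Z → ℝ) (δ : ℝ) (x : E d) (z : Fin b → Z)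
    (u : Fin b → Fin d → Sph d) : E d :=
  (1 / (b : ℝ)) • ∑ i, (1 / (d : ℝ)) • ∑ j,
    ((d : ℝ) / (2 * δ) *
      (f (x + δ • (u i j : E d)) (z i) - f (x - δ • (u i j : E d)) (z i))) • (u i j : E d)

/-- Zeroth-order estimator of the gradient difference between `x` and `y`. -/
def diffEst {d b : ℕ} {Z : Type*} (f : E d → Z → ℝ) (δ : ℝ) (x y : E d) (z : Fin b → Z)
    (u : Fin b → Fin d → Sph d) : E d :=
  (1 / (b : ℝ)) • ∑ i, (1 / (d : ℝ)) • ∑ j,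
    ((d : ℝ) / δ *
      (f (x + δ • (u i j : E d)) (z i) - f (y + δ • (u i j : E d)) (z i))) • (u i j : E d)

/-! ### Tree mechanism -/

/-- The loop of `node`, with exponents `n - 1, ..., 0` still to be tried and current end `k`. -/
def nodeLoop (t : ℕ) : ℕ → ℕ → Finset (ℕ × ℕ)
  | 0, _ => ∅
  | n + 1, k =>
    if k + 2 ^ n ≤ t then insert (k + 1, k + 2 ^ n) (nodeLoop t n (k + 2 ^ n))
    else nodeLoop t n k

/-- The dyadic intervals decomposing `{1, ..., t}`; exponents run from `⌈log₂ t⌉` down to `0`.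
For instance `node 7 = {(1,4), (5,6), (7,7)}`. -/
def node (t : ℕ) : Finset (ℕ × ℕ) := nodeLoop t (Nat.clog 2 t + 1) 0

/-- The noise added in round `t` (rounds are `1, ..., T`): the sum of `ξ_i` over `(·, i) ∈ node t`.
The noise vector of round `i` is stored as `ξ ⟨i - 1, _⟩`. -/
def treeNoise {d T : ℕ} (ξ : Fin T → E d) (t : ℕ) : E d :=
  ∑ p ∈ node t, ∑ i : Fin T with i.val + 1 = p.2, ξ i

/-! ### Online-to-nonconvex conversion with the private variance-reduced oracle

Rounds are indexed from `0`: `k : Fin K` and `t : Fin T` stand for rounds `k + 1` and `t + 1`. -/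

/-- A (possibly randomized) online algorithm for linear losses on `E d`: it draws a random seed,
and its decision in round `t + 1` is a measurable function of the seed and of the `t` loss vectors
received so far. A deterministic algorithm is the case of a one-point seed space. -/
structure OCOAlgorithm (Seed : Type*) [MeasurableSpace Seed] (d : ℕ) where
  seedLaw : Measure Seed
  isProbabilityMeasure_seedLaw : IsProbabilityMeasure seedLaw
  next : (t : ℕ) → Seed → (Fin t → E d) → E d
  measurable_next : ∀ t, Measurable fun p : Seed × (Fin t → E d) => next t p.1 p.2

/-- The domain of the online algorithm is bounded by `D`. -/
def OCOAlgorithm.HasDomainBound {Seed : Type*} [MeasurableSpace Seed] {d : ℕ}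
    (A : OCOAlgorithm Seed d) (D : ℝ) : Prop :=
  ∀ t seed history, ‖A.next t seed history‖ ≤ D

/-- The batch of the first inner round has size `B₁`, all others have size `B₂`. -/
def batchSize (B₁ B₂ t : ℕ) : ℕ := if t = 0 then B₁ else B₂

/-- Labels of the data points: outer round, inner round, position in the batch. -/
abbrev BatchIdx (K T B₁ B₂ : ℕ) : Type :=
  Σ _ : Fin K, Σ t : Fin T, Fin (batchSize B₁ B₂ t)

/-- The randomness of one outer round: seed of the online algorithm, the interpolation parameters
`s_t`, the directions `u` used by the estimators, and the noise vectors `ξ_t`. -/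
abbrev RoundRandomness (Seed : Type*) (d T B₁ B₂ : ℕ) : Type _ :=
  Seed × (Fin T → unitInterval) ×
    ((t : Fin T) → Fin (batchSize B₁ B₂ t) → Fin d → Sph d) × (Fin T → E d)

/-- The Gaussian distribution `N(0, σ² I)` on `E d`. -/
def gaussianNoise (d : ℕ) (σ : ℝ) : Measure (E d) :=
  (stdGaussian (E d)).map fun x => σ • x

/-- All random variables of an outer round are independent. -/
def roundLaw {Seed : Type*} [MeasurableSpace Seed] {d : ℕ} (A : OCOAlgorithm Seed d)
    {T : ℕ} (B₁ B₂ : ℕ) (σ : Fin T → ℝ) : Measure (RoundRandomness Seed d T B₁ B₂) :=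
  A.seedLaw.prod <|
    (Measure.pi fun _ : Fin T => (volume : Measure unitInterval)).prod <|
      (Measure.pi fun t : Fin T => Measure.pi fun _ : Fin (batchSize B₁ B₂ t) =>
        Measure.pi fun _ : Fin d => unifSphere d).prod <|
          Measure.pi fun t : Fin T => gaussianNoise d (σ t)

/-- The state of an outer round after `t` inner rounds. -/
structure InnerState (d t : ℕ) where
  /-- the iterate `x_{t+1}` -/
  x : E d
  /-- the last query point `w_t` (irrelevant if `t = 0`) -/
  w : E d
  /-- the last non-private estimate `g_t` (irrelevant if `t = 0`) -/
  g : E d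
  /-- the private estimates returned so far -/
  gPriv : Fin t → E d
  /-- the sum of the query points `w_1, ..., w_t` -/
  wSum : E d

section Algorithm

variable {Z Seed : Type*} [MeasurableSpace Seed] {d T B₁ B₂ : ℕ} (f : E d → Z → ℝ) (δ : ℝ)
  (A : OCOAlgorithm Seed d)

/-- One inner round, on the batches `batch` and with the randomness `ω`. -/
def innerStep (batch : (t : Fin T) → Fin (batchSize B₁ B₂ t) → Z)
    (ω : RoundRandomness Seed d T B₁ B₂) (t : Fin T) (S : InnerState d t) :
    InnerState d (t + 1) :=
  let seed := ω.1
  let s : ℝ := ω.2.1 t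
  let u := ω.2.2.1 t
  let ξ := ω.2.2.2
  let Δ := A.next t seed S.gPriv
  let w := S.x + s • Δ
  let g := if t.val = 0 then gradEst f δ w (batch t) u else S.g + diffEst f δ w S.w (batch t) u
  { x := S.x + Δ
    w := w
    g := g
    gPriv := Fin.snoc S.gPriv (g + treeNoise ξ (t + 1))
    wSum := S.wSum + w }

/-- The state after `t` inner rounds of an outer round started at `x₁` with a fresh online
algorithm. -/
def innerState (batch : (t : Fin T) → Fin (batchSize B₁ B₂ t) → Z)
    (ω : RoundRandomness Seed d T B₁ B₂) (x₁ : E d) : (t : ℕ) → t ≤ T → InnerState d t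
  | 0, _ => ⟨x₁, 0, 0, Fin.elim0, 0⟩
  | t + 1, h => innerStep f δ A batch ω ⟨t, h⟩ (innerState batch ω x₁ t (Nat.le_of_succ_le h))

/-- The starting point of outer round `k + 1`. -/
def outerStart {K : ℕ} (batch : Fin K → (t : Fin T) → Fin (batchSize B₁ B₂ t) → Z)
    (ω : Fin K → RoundRandomness Seed d T B₁ B₂) (x₁ : E d) : (k : ℕ) → k ≤ K → E d
  | 0, _ => x₁
  | k + 1, h =>
    (innerState f δ A (batch ⟨k, h⟩) (ω ⟨k, h⟩)
      (outerStart batch ω x₁ k (Nat.le_of_succ_le h)) T le_rfl).x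

/-- The average of the query points of an outer round. -/
def roundAverage {K : ℕ} (batch : Fin K → (t : Fin T) → Fin (batchSize B₁ B₂ t) → Z)
    (ω : Fin K → RoundRandomness Seed d T B₁ B₂) (x₁ : E d) (k : Fin K) : E d :=
  (1 / (T : ℝ)) • (innerState f δ A (batch k) (ω k)
    (outerStart f δ A batch ω x₁ k k.isLt.le) T le_rfl).wSum

/-- The law of the output of the algorithm on the dataset `D`. The `M` data points are partitioned
into batches by `part`, tree noise `t` is `N(0, σ_t² I)`, the outer rounds use independent
randomness, and the output is a uniformly chosen round average. -/
def outputLaw {K M : ℕ} (part : BatchIdx K T B₁ B₂ ≃ Fin M) (σ : Fin T → ℝ) (x₁ : E d)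
    (D : Fin M → Z) : Measure (E d) :=
  ((Measure.pi fun _ : Fin K => roundLaw A B₁ B₂ σ).prod
    (uniformOn (Set.univ : Set (Fin K)))).map
      fun ω => roundAverage f δ A (fun k t i => D (part ⟨k, t, i⟩)) ω.1 x₁ ω.2

end Algorithm

end PrivateO2NC

end

/-! The proof is a coupling by shifted noise. The data point that changes enters a single estimate,
in round t₀ of one outer round, and changes it by a vector v. The g_t accumulate increments, so v
persists in every g_t with t ≥ t₀ of that outer round. For t ≥ t₀ exactly one dyadic interval of the
decomposition of {1, ..., t} contains t₀. Adding v to the noise of the intervals containing t₀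
therefore cancels the change, and the run on the new dataset repeats the old one exactly
(`innerState_roundShift`, `roundAverage_outerShift`). What remains is the cost of shifting the
noise.

This cost is measured in dual form. `DualBound` constants multiply under adaptive composition
(`DualBound.pi_add`), survive post-processing by composition with the test function, and yield a
Rényi bound (`renyiDiv_le_of_dual`). Shifting N(0, σ²I) by v costs exp((α-1)/2 · ‖v‖²/σ²)
(`dualBound_gaussianNoise`).

Both batch sizes lead to ‖v‖ ≤ S = 4dL/(B₂T) (`norm_estimateGap_le`). The private estimate of round
T is never read, so only intervals ending before T are shifted, at most ⌈log₂ T⌉ ≤ 2 ln T of them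
(`card_covers_le`, `clog_two_le_two_mul_log`). For σ² = 2 ln T · S²/ρ² the terms ‖v‖²/σ² sum to at
most ρ². -/

noncomputable section

namespace PrivateO2NC

/-! ### Dual bounds on the density of a perturbed law -/

section DualBound

variable {X Y : Type*} [MeasurableSpace X] [MeasurableSpace Y]

/-- The law of `Φ` under `ν` is controlled by `ν` in the dual norm: for `q` the exponent conjugate
to `α`, this says that the law has a density with respect to `ν` of norm at most `C` in `L^α`. -/
def DualBound (q : ℝ) (C : ℝ≥0∞) (ν : Measure X) (Φ : X → X) : Prop :=
  ∀ g : X → ℝ≥0∞, Measurable g → ∫⁻ x, g (Φ x) ∂ν ≤ C * (∫⁻ x, g x ^ q ∂ν) ^ (1 / q)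

theorem DualBound.mono {q : ℝ} {C C' : ℝ≥0∞} {ν : Measure X} {Φ : X → X}
    (h : DualBound q C ν Φ) (hC : C ≤ C') : DualBound q C' ν Φ :=
  fun g hg => (h g hg).trans (by gcongr)

theorem DualBound.id {α q : ℝ} (hq : α.HolderConjugate q) (ν : Measure X)
    [IsProbabilityMeasure ν] : DualBound q 1 ν fun x => x := by
  intro g hg
  have := ENNReal.lintegral_mul_le_Lp_mul_Lq ν hq (f := fun _ => 1) (g := g) (by fun_prop)
    hg.aemeasurable
  simpa using this

/-- After the second variable is integrated out, the partial L^q norm of `g` is itself a test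
function of the first variable. The second map sees the unshifted first coordinate, which is what
adaptivity requires. -/
theorem DualBound.prod {q : ℝ} (hq : 0 < q) {C₁ C₂ : ℝ≥0∞} {ν₁ : Measure X} {ν₂ : Measure Y}
    [SFinite ν₁] [SFinite ν₂] {Φ : X → X} {Ψ : X → Y → Y} (hΦ : Measurable Φ)
    (hΨ : Measurable fun p : X × Y => Ψ p.1 p.2) (h₁ : DualBound q C₁ ν₁ Φ)
    (h₂ : ∀ x, DualBound q C₂ ν₂ (Ψ x)) :
    DualBound q (C₁ * C₂) (ν₁.prod ν₂) fun p => (Φ p.1, Ψ p.1 p.2) := by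
  intro g hg
  have hm : Measurable fun p : X × Y => g p ^ q := hg.pow_const q
  have hG : Measurable fun x => (∫⁻ y, g (x, y) ^ q ∂ν₂) ^ (1 / q) :=
    (hm.lintegral_prod_right').pow_const _
  calc ∫⁻ p, g (Φ p.1, Ψ p.1 p.2) ∂(ν₁.prod ν₂)
      = ∫⁻ x, ∫⁻ y, g (Φ x, Ψ x y) ∂ν₂ ∂ν₁ := by
        rw [lintegral_prod _ (by fun_prop)]
    _ ≤ ∫⁻ x, C₂ * (∫⁻ y, g (Φ x, y) ^ q ∂ν₂) ^ (1 / q) ∂ν₁ := by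
        gcongr with x
        exact h₂ x (fun y => g (Φ x, y)) (by fun_prop)
    _ = C₂ * ∫⁻ x, (∫⁻ y, g (Φ x, y) ^ q ∂ν₂) ^ (1 / q) ∂ν₁ :=
        lintegral_const_mul _ (hG.comp hΦ)
    _ ≤ C₂ * (C₁ * (∫⁻ x, ((∫⁻ y, g (x, y) ^ q ∂ν₂) ^ (1 / q)) ^ q ∂ν₁) ^ (1 / q)) := by
        gcongr
        exact h₁ _ hG
    _ = C₁ * C₂ * (∫⁻ p, g p ^ q ∂(ν₁.prod ν₂)) ^ (1 / q) := by
        rw [lintegral_prod _ hm.aemeasurable, ← mul_assoc, mul_comm C₂]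
        simp [← ENNReal.rpow_mul, hq.ne']

theorem DualBound.of_equiv {q : ℝ} {C : ℝ≥0∞} {μ : Measure X} {ν : Measure Y} (e : X ≃ᵐ Y)
    (he : MeasurePreserving e μ ν) {Φ : X → X} {Ψ : Y → Y} (hΦ : ∀ x, e (Φ x) = Ψ (e x))
    (h : DualBound q C ν Ψ) : DualBound q C μ Φ := by
  intro g hg
  have h' := h (fun y => g (e.symm y)) (by fun_prop)
  rw [← he.lintegral_comp_emb e.measurableEmbedding,
    ← he.lintegral_comp_emb e.measurableEmbedding] at h'
  simpa [← hΦ] using h'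

/-- Adaptive composition: shifts of independent coordinates, where the shift of a coordinate may
depend on the preceding coordinates. -/
theorem DualBound.pi_add {α q : ℝ} (hq : α.HolderConjugate q) [Add X] [MeasurableAdd₂ X] {n : ℕ}
    (ν : Fin n → Measure X) [∀ i, IsProbabilityMeasure (ν i)] (C : Fin n → ℝ≥0∞)
    (c : Fin n → (Fin n → X) → X) (hc : ∀ i, Measurable (c i))
    (hdep : ∀ i x y, (∀ j < i, x j = y j) → c i x = c i y)
    (h : ∀ i x, DualBound q (C i) (ν i) fun y => y + c i x) :
    DualBound q (∏ i, C i) (Measure.pi ν) fun x i => x i + c i x := by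
  induction n with
  | zero =>
    convert DualBound.id hq (Measure.pi ν) using 1
    simp
  | succ n ih =>
    -- `x₀` fills the last slot when a shift of an earlier coordinate is read as a function of `n`
    -- variables; by `hdep` its value is immaterial.
    rcases isEmpty_or_nonempty X with hX | ⟨⟨x₀⟩⟩
    · exact (IsProbabilityMeasure.ne_zero (ν 0) (Measure.eq_zero_of_isEmpty _)).elim
    have hsnoc : Measurable fun x : Fin n → X => (Fin.snoc x x₀ : Fin (n + 1) → X) := by
      refine measurable_pi_lambda _ fun i => ?_
      refine Fin.lastCases ?_ (fun j => ?_) i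
      · simp
      · simpa using measurable_pi_apply j
    have ih' := ih (fun i => ν i.castSucc) (fun i => C i.castSucc)
      (fun i x => c i.castSucc (Fin.snoc x x₀)) (fun i => (hc _).comp hsnoc)
      (fun i x y hxy => hdep _ _ _ fun j => by
        refine Fin.lastCases ?_ (fun k hk => ?_) j
        · intro hk
          exact absurd hk (Fin.castSucc_lt_last i).not_gt
        · simpa using hxy k (by simpa using hk))
      (fun i x => h _ _)
    have hp := DualBound.prod (hq.symm.pos)
      (ν₂ := ν (Fin.last n)) (Ψ := fun x y => y + c (Fin.last n) (Fin.snoc x x₀))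
      (measurable_pi_lambda _ fun i =>
        (measurable_pi_apply i).add ((hc i.castSucc).comp hsnoc))
      (measurable_snd.add ((hc (Fin.last n)).comp (hsnoc.comp measurable_fst))) ih'
      (fun x => h _ _)
    rw [Fin.prod_univ_castSucc]
    refine DualBound.of_equiv
      ((MeasurableEquiv.piFinSuccAbove (fun _ => X) (Fin.last n)).trans MeasurableEquiv.prodComm)
      (MeasurePreserving.trans (measurePreserving_piFinSuccAbove ν (Fin.last n)) ?_) ?_ hp
    · have := Measure.measurePreserving_swap (μ := ν (Fin.last n))
        (ν := Measure.pi fun j => ν ((Fin.last n).succAbove j))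
      simp only [Fin.succAbove_last] at this ⊢
      exact this
    · intro x
      have hswap : ∀ p : X × (Fin n → X), MeasurableEquiv.prodComm p = p.swap := fun _ => rfl
      have key : ∀ i, c i x = c i (Fin.snoc (fun j : Fin n => x j.castSucc) x₀) := by
        intro i
        refine hdep i _ _ fun j => ?_
        refine Fin.lastCases ?_ (fun k hk => ?_) j
        · intro hk
          exact absurd (Fin.le_last i) hk.not_ge
        · simp
      refine Prod.ext ?_ ?_
      · funext i
        have := key i.castSucc
        simpa [hswap, Fin.init_def] using congrArg (x i.castSucc + ·) this
      · have := key (Fin.last n)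
        simpa [hswap, Fin.init_def] using congrArg (x (Fin.last n) + ·) this

end DualBound


/-! ### From dual bounds to Rényi divergence -/

section Renyi

variable {X : Type*} [MeasurableSpace X]

theorem absolutelyContinuous_of_dual {q : ℝ} (hq : 0 < q) {μ ν : Measure X} {C : ℝ≥0∞}
    (hμν : ∀ g : X → ℝ≥0∞, Measurable g → ∫⁻ x, g x ∂μ ≤ C * (∫⁻ x, g x ^ q ∂ν) ^ (1 / q)) :
    μ ≪ ν := by
  refine Measure.AbsolutelyContinuous.mk fun s hs h0 => ?_
  have h := hμν (s.indicator fun _ => 1) (measurable_const.indicator hs)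
  have hpow : (fun x => s.indicator (fun _ => (1 : ℝ≥0∞)) x ^ q) = s.indicator fun _ => 1 := by
    funext x
    by_cases hx : x ∈ s <;> simp [hx, hq]
  rw [hpow, lintegral_indicator_const hs, lintegral_indicator_const hs, h0] at h
  simpa [hq] using h

/-- The extremal test function in Hölder's inequality is h^(α-1) with h = dμ/dν, since (α-1)q = α.
Truncating h at n keeps the integral finite, so that one may divide by it; monotone convergence
removes the truncation. -/
theorem lintegral_rnDeriv_rpow_le_of_dual {α q : ℝ} (hq : α.HolderConjugate q) {μ ν : Measure X}
    [IsFiniteMeasure μ] [IsFiniteMeasure ν] {C : ℝ≥0∞}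
    (hμν : ∀ g : X → ℝ≥0∞, Measurable g → ∫⁻ x, g x ∂μ ≤ C * (∫⁻ x, g x ^ q ∂ν) ^ (1 / q)) :
    ∫⁻ x, (μ.rnDeriv ν x) ^ α ∂ν ≤ C ^ α := by
  have hac := absolutelyContinuous_of_dual hq.symm.pos hμν
  have hα : 0 < α := hq.pos
  have hα1 : 0 < α - 1 := hq.sub_one_pos
  set h := μ.rnDeriv ν with hh
  have hm : Measurable h := Measure.measurable_rnDeriv μ ν
  have hn : ∀ n : ℕ, ∫⁻ x, (min (h x) n) ^ α ∂ν ≤ C ^ α := by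
    intro n
    set I := ∫⁻ x, (min (h x) n) ^ α ∂ν with hI
    have hIfin : I ≠ ⊤ := by
      refine ne_top_of_le_ne_top ?_ (lintegral_mono fun x =>
        ENNReal.rpow_le_rpow (min_le_right (h x) (n : ℝ≥0∞)) hα.le)
      simp [ENNReal.mul_eq_top, ENNReal.rpow_eq_top_iff, hα.not_gt]
    have h1 := hμν (fun x => (min (h x) n) ^ (α - 1)) (by fun_prop)
    have h2 : I ≤ ∫⁻ x, (min (h x) n) ^ (α - 1) ∂μ := by
      conv_rhs => rw [← Measure.withDensity_rnDeriv_eq μ ν hac]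
      rw [lintegral_withDensity_eq_lintegral_mul _ (Measure.measurable_rnDeriv μ ν) (by fun_prop)]
      refine lintegral_mono fun x => ?_
      have : (min (h x) n) ^ α = min (h x) n * (min (h x) n) ^ (α - 1) := by
        conv_lhs => rw [show α = 1 + (α - 1) by ring]
        rw [ENNReal.rpow_add_of_nonneg _ _ zero_le_one hα1.le, ENNReal.rpow_one]
      rw [this]
      simp only [Pi.mul_apply]
      gcongr
      exact min_le_left _ _
    have h3 : ∀ x, ((min (h x) n) ^ (α - 1)) ^ q = (min (h x) n) ^ α := by
      intro x
      rw [← ENNReal.rpow_mul, hq.sub_one_mul_conj]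
    simp only [h3] at h1
    have h4 : I ≤ C * I ^ (1 / q) := h2.trans h1
    rcases eq_or_ne I 0 with h0 | h0
    · rw [h0]; exact zero_le
    -- As 1/α + 1/q = 1, the left side is I, and the factor I^(1/q) cancels.
    have h5 : I ^ (1 / α) * I ^ (1 / q) ≤ C * I ^ (1 / q) := by
      rw [← ENNReal.rpow_add _ _ h0 hIfin, one_div, one_div, hq.inv_add_inv_eq_one,
        ENNReal.rpow_one]
      simpa using h4
    have hne0 : I ^ (1 / q) ≠ 0 := by
      simp [ENNReal.rpow_eq_zero_iff, h0, hIfin]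
    have hnet : I ^ (1 / q) ≠ ⊤ := ENNReal.rpow_ne_top_of_nonneg (by
      have := hq.symm.pos; positivity) hIfin
    have h6 := (ENNReal.mul_le_mul_iff_left hne0 hnet).1 h5
    calc I = (I ^ (1 / α)) ^ α := by rw [← ENNReal.rpow_mul]; simp [hα.ne']
      _ ≤ C ^ α := by gcongr
  have hmono : Monotone fun (n : ℕ) x => (min (h x) n) ^ α := by
    intro m n hmn x
    dsimp only
    gcongr
  have hsup : ∀ x, ⨆ n : ℕ, (min (h x) n) ^ α = h x ^ α := by
    intro x
    refine le_antisymm (iSup_le fun n => by gcongr; exact min_le_left _ _) ?_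
    have ht : Filter.Tendsto (fun n : ℕ => (min (h x) n) ^ α) Filter.atTop
        (nhds ((min (h x) ⊤) ^ α)) :=
      (ENNReal.continuous_rpow_const.tendsto _).comp
        (tendsto_const_nhds.min ENNReal.tendsto_nat_nhds_top)
    rw [min_eq_left le_top] at ht
    exact le_of_tendsto' ht fun n => le_iSup (fun n : ℕ => (min (h x) n) ^ α) n
  calc ∫⁻ x, h x ^ α ∂ν = ∫⁻ x, ⨆ n : ℕ, (min (h x) n) ^ α ∂ν := by simp_rw [hsup]
    _ = ⨆ n : ℕ, ∫⁻ x, (min (h x) n) ^ α ∂ν :=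
        lintegral_iSup (fun n => by fun_prop) hmono
    _ ≤ C ^ α := iSup_le hn

theorem renyiDiv_le_of_dual {α q : ℝ} (hq : α.HolderConjugate q) {μ ν : Measure X}
    [IsFiniteMeasure μ] [IsFiniteMeasure ν] {ε : ℝ}
    (hμν : ∀ g : X → ℝ≥0∞, Measurable g →
      ∫⁻ x, g x ∂μ ≤ ENNReal.ofReal (Real.exp ((α - 1) / α * ε)) *
        (∫⁻ x, g x ^ q ∂ν) ^ (1 / q)) :
    renyiDiv α μ ν ≤ (ε : EReal) := by
  have hα : 0 < α := hq.pos
  have hα1 : 0 < α - 1 := hq.sub_one_pos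
  have hI := lintegral_rnDeriv_rpow_le_of_dual hq hμν
  rw [ENNReal.ofReal_rpow_of_pos (Real.exp_pos _), ← Real.exp_mul] at hI
  have hlog := ENNReal.log_monotone hI
  rw [ENNReal.log_ofReal_of_pos (Real.exp_pos _), Real.log_exp] at hlog
  rw [renyiDiv, if_pos (absolutelyContinuous_of_dual hq.symm.pos hμν)]
  calc _ ≤ (((α - 1)⁻¹ : ℝ) : EReal) * (((α - 1) / α * ε * α : ℝ) : EReal) :=
        mul_le_mul_of_nonneg_left hlog (by exact_mod_cast (inv_pos.2 hα1).le)
    _ = (ε : EReal) := by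
        rw [← EReal.coe_mul]
        congr 1
        field_simp

end Renyi

/-! ### Gaussian shifts -/

section Gaussian

/-- The shifted Gaussian has density `w` with respect to the original one, and Hölder's inequality
leaves the L^α norm of `w`, a value of the Gaussian moment generating function at αa. -/
theorem dualBound_gaussianReal {α q : ℝ} (hq : α.HolderConjugate q) (a : ℝ) :
    DualBound q (ENNReal.ofReal (Real.exp ((α - 1) / 2 * a ^ 2))) (gaussianReal 0 1)
      fun y => y + a := by
  intro g hg
  have hα : 0 < α := hq.pos
  set w : ℝ → ℝ≥0∞ := fun y => ENNReal.ofReal (Real.exp (a * y - a ^ 2 / 2)) with hw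
  have hwm : Measurable w := by fun_prop
  have h1 : ∫⁻ y, g (y + a) ∂(gaussianReal 0 1) = ∫⁻ y, (w * g) y ∂(gaussianReal 0 1) := by
    rw [gaussianReal_of_var_ne_zero 0 one_ne_zero,
      lintegral_withDensity_eq_lintegral_mul _ (measurable_gaussianPDF 0 1) (by fun_prop),
      lintegral_withDensity_eq_lintegral_mul _ (measurable_gaussianPDF 0 1) (hwm.mul hg),
      ← lintegral_sub_right_eq_self _ a]
    refine lintegral_congr fun y => ?_
    simp only [Pi.mul_apply, sub_add_cancel]
    rw [← mul_assoc]
    congr 1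
    simp only [hw, gaussianPDF, gaussianPDFReal]
    rw [← ENNReal.ofReal_mul (by positivity), mul_assoc (√_)⁻¹, ← Real.exp_add]
    congr 3
    simp only [NNReal.coe_one]
    ring
  have h2 : (∫⁻ y, w y ^ α ∂(gaussianReal 0 1)) ^ (1 / α)
      = ENNReal.ofReal (Real.exp ((α - 1) / 2 * a ^ 2)) := by
    have hpt : ∀ y, w y ^ α = ENNReal.ofReal (Real.exp (-(α * a ^ 2 / 2)) *
        Real.exp (α * a * y)) := by
      intro y
      simp only [hw]
      rw [ENNReal.ofReal_rpow_of_pos (Real.exp_pos _), ← Real.exp_mul, ← Real.exp_add]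
      congr 2
      ring
    simp_rw [hpt]
    rw [← ofReal_integral_eq_lintegral_ofReal
      ((integrable_exp_mul_gaussianReal _).const_mul _)
      (Filter.Eventually.of_forall fun y => by positivity), integral_const_mul]
    have hmgf := congrFun (mgf_fun_id_gaussianReal (μ := 0) (v := 1)) (α * a)
    rw [mgf] at hmgf
    rw [hmgf, ← Real.exp_add, ENNReal.ofReal_rpow_of_pos (Real.exp_pos _), ← Real.exp_mul]
    congr 2
    simp only [NNReal.coe_one]
    field_simp
    ring
  rw [h1, ← h2]
  exact ENNReal.lintegral_mul_le_Lp_mul_Lq _ hq hwm.aemeasurable hg.aemeasurable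

theorem dualBound_stdGaussian {α q : ℝ} (hq : α.HolderConjugate q) {d : ℕ} (v : E d) :
    DualBound q (ENNReal.ofReal (Real.exp ((α - 1) / 2 * ‖v‖ ^ 2))) (stdGaussian (E d))
      fun y => y + v := by
  have h := DualBound.pi_add hq (fun _ : Fin d => gaussianReal 0 1)
    (fun i => ENNReal.ofReal (Real.exp ((α - 1) / 2 * v i ^ 2))) (fun i _ => v i)
    (fun i => measurable_const) (fun _ _ _ _ => rfl) fun i _ => dualBound_gaussianReal hq (v i)
  rw [← ENNReal.ofReal_prod_of_nonneg fun i _ => (Real.exp_pos _).le, ← Real.exp_sum,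
    ← Finset.mul_sum, ← EuclideanSpace.real_norm_sq_eq] at h
  refine DualBound.of_equiv (MeasurableEquiv.toLp 2 (Fin d → ℝ)).symm ?_ ?_ h
  · refine MeasurePreserving.symm _ ⟨MeasurableEquiv.measurable _, ?_⟩
    rw [← map_pi_eq_stdGaussian]
    rfl
  · intro x
    rfl

instance isProbabilityMeasure_gaussianNoise (d : ℕ) (σ : ℝ) :
    IsProbabilityMeasure (gaussianNoise d σ) :=
  Measure.isProbabilityMeasure_map (by fun_prop)

/-- The degenerate case σ = 0 does occur, for T = 1 or L = 0. Then only the zero shift is allowed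
and the quotient 0/0 = 0 gives the correct constant 1. -/
theorem dualBound_gaussianNoise {α q : ℝ} (hq : α.HolderConjugate q) {d : ℕ} {σ : ℝ} {v : E d}
    (hv : σ = 0 → v = 0) :
    DualBound q (ENNReal.ofReal (Real.exp ((α - 1) / 2 * (‖v‖ ^ 2 / σ ^ 2))))
      (gaussianNoise d σ) fun y => y + v := by
  intro g hg
  have h := dualBound_stdGaussian hq (σ⁻¹ • v) (fun y => g (σ • y)) (by fun_prop)
  have hσ : σ • σ⁻¹ • v = v := by
    rcases eq_or_ne σ 0 with h0 | h0
    · simp [hv h0]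
    · exact smul_inv_smul₀ h0 v
  have hn : ‖σ⁻¹ • v‖ ^ 2 = ‖v‖ ^ 2 / σ ^ 2 := by
    rw [norm_smul, mul_pow, norm_inv, inv_pow, Real.norm_eq_abs, sq_abs]
    ring
  rw [gaussianNoise, lintegral_map (by fun_prop) (by fun_prop),
    lintegral_map (by fun_prop) (by fun_prop)]
  simpa only [smul_add, hσ, hn] using h

end Gaussian


/-! ### Dyadic intervals -/

section Tree

/-- Round `s` lies in the dyadic interval with right end `b`, i.e. in `(k, b]` where `b = k + 2 ^ e`
and `2 ^ (e + 1)` divides `k`. -/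
def Covers (s b : ℕ) : Prop :=
  ∃ e m, b = 2 ^ (e + 1) * m + 2 ^ e ∧ 2 ^ (e + 1) * m < s ∧ s ≤ b

theorem Covers.le {s b : ℕ} (h : Covers s b) : s ≤ b := by
  obtain ⟨e, m, -, -, h⟩ := h
  exact h

/-- The exponent is the 2-adic valuation of the right end. Hence a right end determines its
interval, and the noise may be indexed by right ends alone. -/
theorem eq_of_dyadic_eq {e e' m m' : ℕ}
    (h : 2 ^ (e + 1) * m + 2 ^ e = 2 ^ (e' + 1) * m' + 2 ^ e') : e = e' := by
  wlog hlt : e < e' generalizing e e' m m'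
  · rcases (not_lt.1 hlt).eq_or_lt with h' | h'
    · exact h'.symm
    · exact (this h.symm h').symm
  have h1 : 2 ^ (e + 1) ∣ 2 ^ (e' + 1) * m' + 2 ^ e' :=
    dvd_add ((pow_dvd_pow 2 (by omega)).mul_right _) (pow_dvd_pow 2 (by omega))
  rw [← h] at h1
  have h2 : 2 ^ (e + 1) ∣ 2 ^ e := (Nat.dvd_add_right (dvd_mul_right _ _)).1 h1
  have := (Nat.pow_dvd_pow_iff_le_right (by norm_num)).1 h2
  omega

theorem covers_dyadic {s e m : ℕ} :
    Covers s (2 ^ (e + 1) * m + 2 ^ e) ↔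
      2 ^ (e + 1) * m < s ∧ s ≤ 2 ^ (e + 1) * m + 2 ^ e := by
  refine ⟨?_, fun h => ⟨e, m, rfl, h⟩⟩
  rintro ⟨e', m', h, h1, h2⟩
  obtain rfl := eq_of_dyadic_eq h
  exact ⟨by omega, h2⟩

theorem nodeLoop_bounds {t : ℕ} : ∀ {n k : ℕ} {p : ℕ × ℕ}, p ∈ nodeLoop t n k →
    k < p.2 ∧ p.2 ≤ t
  | 0, _, _, hp => by simp [nodeLoop] at hp
  | n + 1, k, p, hp => by
    have h2 : 0 < 2 ^ n := by positivity
    rw [nodeLoop] at hp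
    split_ifs at hp with h
    · rcases Finset.mem_insert.1 hp with rfl | hp
      · exact ⟨by simp, h⟩
      · have := nodeLoop_bounds hp
        omega
    · exact nodeLoop_bounds hp

-- The loop tiles (k, t] by disjoint dyadic intervals, so `s` lies in exactly one of them or in
-- none. Divisibility of `k` by 2^n is the invariant that makes each inserted interval dyadic in the
-- sense of `Covers`.
open Classical in
theorem sum_nodeLoop_covers {V : Type*} [AddCommMonoid V] (v : V) (s t : ℕ) :
    ∀ n k : ℕ, 2 ^ n ∣ k → k ≤ t → t < k + 2 ^ n →
      ∑ p ∈ nodeLoop t n k, (if Covers s p.2 then v else 0) = if k < s ∧ s ≤ t then v else 0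
  | 0, k, _, h1, h2 => by
    have : ¬ (k < s ∧ s ≤ t) := by simp at h2; omega
    simp [nodeLoop, this]
  | n + 1, k, hk, h1, h2 => by
    have hp : 2 ^ (n + 1) = 2 ^ n + 2 ^ n := by rw [pow_succ]; ring
    have hdvd : 2 ^ n ∣ k := (pow_dvd_pow 2 (by omega)).trans hk
    rw [nodeLoop]
    split_ifs with h h' h'
    · rw [Finset.sum_insert fun hm => (nodeLoop_bounds hm).1.false,
        sum_nodeLoop_covers v s t n _ (dvd_add hdvd dvd_rfl) h (by omega)]
      obtain ⟨m, rfl⟩ := hk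
      simp only [covers_dyadic]
      by_cases hs : s ≤ 2 ^ (n + 1) * m + 2 ^ n
      · simp [hs, h'.1, hs.not_gt]
      · simp [hs, h'.2, not_le.1 hs]
    · rw [Finset.sum_insert fun hm => (nodeLoop_bounds hm).1.false,
        sum_nodeLoop_covers v s t n _ (dvd_add hdvd dvd_rfl) h (by omega)]
      obtain ⟨m, rfl⟩ := hk
      simp only [covers_dyadic]
      rw [if_neg (by omega), if_neg (by omega), add_zero]
    · rw [sum_nodeLoop_covers v s t n _ hdvd h1 (by omega), if_pos h']
    · rw [sum_nodeLoop_covers v s t n _ hdvd h1 (by omega), if_neg h']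

open Classical in
theorem sum_node_covers {V : Type*} [AddCommMonoid V] (v : V) {s : ℕ} (hs : 1 ≤ s) (t : ℕ) :
    ∑ p ∈ node t, (if Covers s p.2 then v else 0) = if s ≤ t then v else 0 := by
  have ht : t < 0 + 2 ^ (Nat.clog 2 t + 1) := by
    have := Nat.le_pow_clog (b := 2) (by norm_num) t
    have h2 : 0 < 2 ^ Nat.clog 2 t := by positivity
    rw [pow_succ]
    omega
  rw [node, sum_nodeLoop_covers v s t _ 0 (dvd_zero _) (Nat.zero_le t) ht]
  simp only [Nat.pos_of_ne_zero (by omega : s ≠ 0), true_and]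

theorem node_bounds {t : ℕ} {p : ℕ × ℕ} (hp : p ∈ node t) : 1 ≤ p.2 ∧ p.2 ≤ t :=
  nodeLoop_bounds hp

theorem treeNoise_add {d T : ℕ} (ξ η : Fin T → E d) (t : ℕ) :
    treeNoise (fun i => ξ i + η i) t = treeNoise ξ t + treeNoise η t := by
  simp only [treeNoise, Finset.sum_add_distrib]

open Classical in
/-- Moving the noise of every dyadic interval that contains round `s` by `v` moves the tree noise of
the rounds `t ≥ s` by `v`, and needs no change of the noise of rounds after `t`. -/
theorem treeNoise_covers {d T : ℕ} (v : E d) {s t : ℕ} (hs : 1 ≤ s) (ht : t < T) :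
    treeNoise (fun i : Fin T => if i.val + 1 < T ∧ Covers s (i.val + 1) then v else 0) t =
      if s ≤ t then v else 0 := by
  rw [← sum_node_covers v hs t, treeNoise]
  refine Finset.sum_congr rfl fun p hp => ?_
  obtain ⟨h1, h2⟩ := node_bounds hp
  have : (Finset.univ.filter fun i : Fin T => i.val + 1 = p.2) = {⟨p.2 - 1, by omega⟩} := by
    ext i
    simp [Fin.ext_iff]
    omega
  rw [this, Finset.sum_singleton]
  have h3 : p.2 - 1 + 1 = p.2 := by omega
  simp only [h3, (show p.2 < T by omega), true_and]

-- Each scale `e` has at most one interval containing `s`, and 2^e ≤ b < T leaves `Nat.clog 2 T`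
-- scales. Allowing b = T would add one more when T is a power of two.
open Classical in
theorem card_covers_le (s T : ℕ) (hs : 1 ≤ s) :
    (Finset.univ.filter fun i : Fin T => i.val + 1 < T ∧ Covers s (i.val + 1)).card
      ≤ Nat.clog 2 T := by
  rw [← Finset.card_image_of_injective _
    (f := fun i : Fin T => i.val + 1) fun i j h => Fin.ext (Nat.succ_injective h)]
  calc _ ≤ ((Finset.range (Nat.clog 2 T)).image
        fun e => 2 ^ (e + 1) * ((s - 1) / 2 ^ (e + 1)) + 2 ^ e).card := by
        refine Finset.card_le_card fun b hb => ?_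
        obtain ⟨i, hi, rfl⟩ := Finset.mem_image.1 hb
        obtain ⟨hiT, e, m, he, h1, h2⟩ := (Finset.mem_filter.1 hi).2
        refine Finset.mem_image.2 ⟨e, Finset.mem_range.2 ?_, ?_⟩
        · rw [Nat.lt_clog_iff_pow_lt (by norm_num)]
          exact lt_of_le_of_lt (he ▸ Nat.le_add_left _ _) hiT
        · have hp : 2 ^ (e + 1) = 2 ^ e + 2 ^ e := by rw [pow_succ]; ring
          have hm : (s - 1) / 2 ^ (e + 1) = m :=
            Nat.div_eq_of_lt_le (by rw [mul_comm]; omega)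
              (by rw [mul_comm, mul_add]; omega)
          rw [hm, he]
    _ ≤ _ := Finset.card_image_le.trans_eq (Finset.card_range _)

theorem clog_two_le_two_mul_log {T : ℕ} (hT : 2 ≤ T) :
    (Nat.clog 2 T : ℝ) ≤ 2 * Real.log T := by
  obtain ⟨n, hn⟩ : ∃ n, Nat.clog 2 T = n + 1 :=
    ⟨_, (Nat.succ_pred_eq_of_pos (Nat.clog_pos (by norm_num) hT)).symm⟩
  have hlt : 2 ^ n < T := Nat.pow_lt_of_lt_clog (by omega)
  have hT' : ((2 ^ n + 1 : ℕ) : ℝ) ≤ T := by exact_mod_cast hlt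
  have hlog : Real.log ((2 ^ n + 1 : ℕ) : ℝ) ≤ Real.log T := Real.log_le_log (by positivity) hT'
  have hl2 := Real.log_two_gt_d9
  have he := Real.exp_one_lt_d9
  rw [hn]
  have key : ((n + 1 : ℕ) : ℝ) ≤ 2 * Real.log ((2 ^ n + 1 : ℕ) : ℝ) := by
    -- The worst case is T = 2^n + 1. For n ≥ 3 the estimate 2n ln 2 ≥ n + 1 suffices; smaller n are
    -- checked through e^(n+1) ≤ (2^n + 1)².
    rcases Nat.lt_or_ge n 3 with h3 | h3
    · have h' : ((n + 1 : ℕ) : ℝ) ≤ Real.log (((2 ^ n + 1 : ℕ) : ℝ) ^ 2) := by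
        rw [Real.le_log_iff_exp_le (by positivity), ← mul_one ((n + 1 : ℕ) : ℝ), Real.exp_nat_mul]
        calc Real.exp 1 ^ (n + 1) ≤ 2.7182818286 ^ (n + 1) := by gcongr
          _ ≤ _ := by interval_cases n <;> norm_num
      rwa [Real.log_pow, Nat.cast_ofNat] at h'
    · have h' : Real.log ((2 : ℝ) ^ n) ≤ Real.log ((2 ^ n + 1 : ℕ) : ℝ) :=
        Real.log_le_log (by positivity) (by push_cast; linarith)
      rw [Real.log_pow] at h'
      have h3' : (3 : ℝ) ≤ n := by exact_mod_cast h3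
      push_cast at h' ⊢
      nlinarith
  linarith

end Tree


/-! ### Sensitivity of the estimators -/

section Sensitivity

variable {Z : Type*} {d b : ℕ} {f : E d → Z → ℝ} {L : ℝ≥0}

/-- An average over a batch moves by at most `2 * C / b` if one data point is replaced. -/
theorem norm_batchMean_sub_le {V : Type*} [NormedAddCommGroup V] [NormedSpace ℝ V]
    (φ : Z → Fin b → V) {C : ℝ} (hφ : ∀ z i, ‖φ z i‖ ≤ C) {z z' : Fin b → Z} {i₀ : Fin b}
    (hz : ∀ i, i ≠ i₀ → z i = z' i) :
    ‖(1 / (b : ℝ)) • ∑ i, φ (z i) i - (1 / (b : ℝ)) • ∑ i, φ (z' i) i‖ ≤ 2 * C / b := by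
  rw [← smul_sub, ← Finset.sum_sub_distrib, Finset.sum_eq_single i₀
    (fun i _ hi => by rw [hz i hi, sub_self]) (by simp), norm_smul, Real.norm_of_nonneg
    (by positivity)]
  calc 1 / (b : ℝ) * ‖φ (z i₀) i₀ - φ (z' i₀) i₀‖ ≤ 1 / (b : ℝ) * (C + C) := by
        gcongr
        exact (norm_sub_le _ _).trans (add_le_add (hφ _ _) (hφ _ _))
    _ = 2 * C / b := by ring

theorem norm_mean_smul_sphere_le (hd : 1 ≤ d) (a : Fin d → ℝ) (u : Fin d → Sph d) {C : ℝ}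
    (ha : ∀ j, |a j| ≤ C) : ‖(1 / (d : ℝ)) • ∑ j, a j • (u j : E d)‖ ≤ C := by
  have hd' : (0 : ℝ) < d := by exact_mod_cast hd
  rw [norm_smul, Real.norm_of_nonneg (by positivity)]
  calc 1 / (d : ℝ) * ‖∑ j, a j • (u j : E d)‖ ≤ 1 / (d : ℝ) * ∑ _j : Fin d, C := by
        gcongr
        refine norm_sum_le_of_le _ fun j _ => ?_
        rw [norm_smul, Real.norm_eq_abs, norm_eq_of_mem_sphere, mul_one]
        exact ha j
    _ = C := by simp; field_simp

theorem norm_gradEst_sub_le (hd : 1 ≤ d) (hf : ∀ z, LipschitzWith L fun x => f x z) {δ : ℝ}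
    (hδ : 0 < δ) (x : E d) {z z' : Fin b → Z} {i₀ : Fin b} (hz : ∀ i, i ≠ i₀ → z i = z' i)
    (u : Fin b → Fin d → Sph d) :
    ‖gradEst f δ x z u - gradEst f δ x z' u‖ ≤ 2 * (d * L) / b := by
  refine norm_batchMean_sub_le (fun z i => (1 / (d : ℝ)) • ∑ j, ((d : ℝ) / (2 * δ) *
      (f (x + δ • (u i j : E d)) z - f (x - δ • (u i j : E d)) z)) • (u i j : E d))
    (fun z i => norm_mean_smul_sphere_le hd _ _ fun j => ?_) hz
  rw [abs_mul, abs_of_nonneg (by positivity)]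
  have h := (hf z).dist_le_mul (x + δ • (u i j : E d)) (x - δ • (u i j : E d))
  rw [Real.dist_eq, dist_eq_norm, show x + δ • (u i j : E d) - (x - δ • (u i j : E d))
    = (2 * δ) • (u i j : E d) by module, norm_smul, norm_eq_of_mem_sphere,
    Real.norm_of_nonneg (by positivity), mul_one] at h
  calc _ ≤ (d : ℝ) / (2 * δ) * (L * (2 * δ)) := by gcongr
    _ = d * L := by field_simp

/-- Both evaluations use the same direction, so the Lipschitz bound brings in the distance of the
query points; its smallness is what gains the factor 1/T. -/
theorem norm_diffEst_sub_le (hd : 1 ≤ d) (hf : ∀ z, LipschitzWith L fun x => f x z) {δ : ℝ}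
    (hδ : 0 < δ) (x y : E d) {z z' : Fin b → Z} {i₀ : Fin b} (hz : ∀ i, i ≠ i₀ → z i = z' i)
    (u : Fin b → Fin d → Sph d) :
    ‖diffEst f δ x y z u - diffEst f δ x y z' u‖ ≤ 2 * (d / δ * (L * ‖x - y‖)) / b := by
  refine norm_batchMean_sub_le (fun z i => (1 / (d : ℝ)) • ∑ j, ((d : ℝ) / δ *
      (f (x + δ • (u i j : E d)) z - f (y + δ • (u i j : E d)) z)) • (u i j : E d))
    (fun z i => norm_mean_smul_sphere_le hd _ _ fun j => ?_) hz
  rw [abs_mul, abs_of_nonneg (by positivity)]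
  have h := (hf z).dist_le_mul (x + δ • (u i j : E d)) (y + δ • (u i j : E d))
  rw [Real.dist_eq, dist_eq_norm, add_sub_add_right_eq_sub] at h
  gcongr

end Sensitivity

/-! ### Measurability of the algorithm -/

section Measurability

variable {Z Seed Ω : Type*} [MeasurableSpace Seed] [MeasurableSpace Ω] {d T B₁ B₂ : ℕ}
  {f : E d → Z → ℝ} {L : ℝ≥0}

theorem measurable_gradEst {b : ℕ} (hf : ∀ z, Measurable fun x => f x z) (δ : ℝ)
    (z : Fin b → Z) {x : Ω → E d} (hx : Measurable x) {u : Ω → Fin b → Fin d → Sph d}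
    (hu : Measurable u) : Measurable fun ω => gradEst f δ (x ω) z (u ω) := by
  have hu' : ∀ i j, Measurable fun ω => (u ω i j : E d) := fun i j => by fun_prop
  unfold gradEst
  have hi : ∀ i j, Measurable fun ω => ((d : ℝ) / (2 * δ) * (f (x ω + δ • (u ω i j : E d)) (z i) -
      f (x ω - δ • (u ω i j : E d)) (z i))) • (u ω i j : E d) := fun i j =>
    ((((hf (z i)).comp (hx.add ((hu' i j).const_smul δ))).sub
      ((hf (z i)).comp (hx.sub ((hu' i j).const_smul δ)))).const_mul _).smul (hu' i j)
  fun_prop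

theorem measurable_diffEst {b : ℕ} (hf : ∀ z, Measurable fun x => f x z) (δ : ℝ)
    (z : Fin b → Z) {x y : Ω → E d} (hx : Measurable x) (hy : Measurable y)
    {u : Ω → Fin b → Fin d → Sph d} (hu : Measurable u) :
    Measurable fun ω => diffEst f δ (x ω) (y ω) z (u ω) := by
  have hu' : ∀ i j, Measurable fun ω => (u ω i j : E d) := fun i j => by fun_prop
  unfold diffEst
  have hi : ∀ i j, Measurable fun ω => ((d : ℝ) / δ * (f (x ω + δ • (u ω i j : E d)) (z i) -
      f (y ω + δ • (u ω i j : E d)) (z i))) • (u ω i j : E d) := fun i j =>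
    ((((hf (z i)).comp (hx.add ((hu' i j).const_smul δ))).sub
      ((hf (z i)).comp (hy.add ((hu' i j).const_smul δ)))).const_mul _).smul (hu' i j)
  fun_prop

theorem measurable_treeNoise (t : ℕ) :
    Measurable fun ξ : Fin T → E d => treeNoise ξ t := by
  unfold treeNoise
  fun_prop

/-- Joint measurability of all components of a random state. -/
structure MeasurableState {t : ℕ} (S : Ω → InnerState d t) : Prop where
  x : Measurable fun ω => (S ω).x
  w : Measurable fun ω => (S ω).w
  g : Measurable fun ω => (S ω).g
  gPriv : Measurable fun ω => (S ω).gPriv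
  wSum : Measurable fun ω => (S ω).wSum

variable (A : OCOAlgorithm Seed d) (δ : ℝ)

theorem measurableState_innerState (hf : ∀ z, Measurable fun x => f x z)
    (batch : (t : Fin T) → Fin (batchSize B₁ B₂ t) → Z)
    {W : Ω → RoundRandomness Seed d T B₁ B₂} (hW : Measurable W) {X : Ω → E d}
    (hX : Measurable X) : ∀ (t : ℕ) (h : t ≤ T),
      MeasurableState fun a => innerState f δ A batch (W a) (X a) t h
  | 0, _ => ⟨hX, measurable_const, measurable_const, measurable_const, measurable_const⟩
  | t + 1, h => by
    have ih := measurableState_innerState hf batch hW hX t (Nat.le_of_succ_le h)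
    have hΔ := (A.measurable_next t).comp (hW.fst.prodMk ih.gPriv)
    have hs : Measurable fun a => ((W a).2.1 ⟨t, h⟩ : ℝ) := by fun_prop
    have hu : Measurable fun a => (W a).2.2.1 ⟨t, h⟩ := by fun_prop
    have hξ := (measurable_treeNoise (t + 1)).comp hW.snd.snd.snd
    have hw := ih.x.add (hs.smul hΔ)
    have hg : Measurable fun a => (innerState f δ A batch (W a) (X a) (t + 1) h).g := by
      simp only [innerState, innerStep]
      split_ifs with h0
      · exact measurable_gradEst hf δ (batch ⟨t, h⟩) hw hu
      · exact ih.g.add (measurable_diffEst hf δ (batch ⟨t, h⟩) hw ih.w hu)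
    refine ⟨ih.x.add hΔ, hw, hg, ?_, ih.wSum.add hw⟩
    refine measurable_pi_lambda _ fun i => ?_
    refine Fin.lastCases ?_ (fun j => ?_) i
    · simp only [innerState, innerStep, Fin.snoc_last]
      exact hg.add hξ
    · simp only [innerState, innerStep, Fin.snoc_castSucc]
      exact (measurable_pi_apply j).comp ih.gPriv

theorem measurable_outerStart {K : ℕ} (hf : ∀ z, Measurable fun x => f x z)
    (batch : Fin K → (t : Fin T) → Fin (batchSize B₁ B₂ t) → Z) (x₁ : E d) :
    ∀ (k : ℕ) (h : k ≤ K), Measurable fun ω => outerStart f δ A batch ω x₁ k h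
  | 0, _ => measurable_const
  | k + 1, h => (measurableState_innerState A δ hf (batch ⟨k, h⟩)
      (W := fun ω : Fin K → RoundRandomness Seed d T B₁ B₂ => ω ⟨k, h⟩) (measurable_pi_apply _)
      (measurable_outerStart hf batch x₁ k (Nat.le_of_succ_le h)) T le_rfl).x

theorem measurable_roundAverage {K : ℕ} (hf : ∀ z, Measurable fun x => f x z)
    (batch : Fin K → (t : Fin T) → Fin (batchSize B₁ B₂ t) → Z) (x₁ : E d) :
    Measurable fun p : (Fin K → RoundRandomness Seed d T B₁ B₂) × Fin K =>
      roundAverage f δ A batch p.1 x₁ p.2 :=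
  measurable_from_prod_countable_left fun k =>
    Measurable.const_smul (measurableState_innerState A δ hf (batch k)
      (W := fun ω : Fin K → RoundRandomness Seed d T B₁ B₂ => ω k) (measurable_pi_apply k)
      (measurable_outerStart A δ hf batch x₁ k k.isLt.le) T le_rfl).wSum (1 / (T : ℝ))

theorem isProbabilityMeasure_unifSphere (hd : 1 ≤ d) : IsProbabilityMeasure (unifSphere d) := by
  have : Nonempty (Fin d) := ⟨⟨0, hd⟩⟩
  refine ⟨?_⟩
  rw [unifSphere, Measure.smul_apply, smul_eq_mul]
  refine ENNReal.inv_mul_cancel ?_ (measure_ne_top _ _)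
  rw [Ne, Measure.measure_univ_eq_zero]
  exact Measure.toSphere_ne_zero _

theorem isProbabilityMeasure_roundLaw (hd : 1 ≤ d) (σ : Fin T → ℝ) :
    IsProbabilityMeasure (roundLaw A B₁ B₂ σ) := by
  have := isProbabilityMeasure_unifSphere hd
  have := A.isProbabilityMeasure_seedLaw
  unfold roundLaw
  infer_instance

theorem isProbabilityMeasure_outputLaw (hd : 1 ≤ d) {K M : ℕ} (hK : 1 ≤ K)
    (hf : ∀ z, Measurable fun x => f x z) (part : BatchIdx K T B₁ B₂ ≃ Fin M) (σ : Fin T → ℝ)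
    (x₁ : E d) (D : Fin M → Z) : IsProbabilityMeasure (outputLaw f δ A part σ x₁ D) := by
  have := isProbabilityMeasure_roundLaw (B₁ := B₁) (B₂ := B₂) A hd σ
  have : Nonempty (Fin K) := ⟨⟨0, hK⟩⟩
  have : IsProbabilityMeasure (uniformOn (Set.univ : Set (Fin K))) :=
    isProbabilityMeasure_uniformOn Set.finite_univ Set.univ_nonempty
  exact Measure.isProbabilityMeasure_map (measurable_roundAverage A δ hf _ x₁).aemeasurable

end Measurability


/-! ### Coupling of the runs on neighboring datasets -/

section Coupling

variable {Z Seed : Type*} [MeasurableSpace Seed] {d T B₁ B₂ : ℕ} (f : E d → Z → ℝ) (δ : ℝ)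
  (A : OCOAlgorithm Seed d)

theorem treeNoise_congr {ξ ξ' : Fin T → E d} {t : ℕ} (h : ∀ j : Fin T, j.val < t → ξ j = ξ' j) :
    treeNoise ξ t = treeNoise ξ' t := by
  refine Finset.sum_congr rfl fun p hp => Finset.sum_congr rfl fun i hi => h i ?_
  have h1 := node_bounds hp
  have h2 := (Finset.mem_filter.1 hi).2
  omega

/-- The state after `t` inner rounds only depends on the noise vectors of these rounds. -/
theorem innerState_congr (batch : (t : Fin T) → Fin (batchSize B₁ B₂ t) → Z)
    {r : Seed} {s : Fin T → unitInterval} {u : (t : Fin T) → Fin (batchSize B₁ B₂ t) → Fin d → Sph d}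
    {ξ ξ' : Fin T → E d} (x₁ : E d) : ∀ (t : ℕ) (h : t ≤ T), (∀ j : Fin T, j.val < t → ξ j = ξ' j) →
      innerState f δ A batch (r, s, u, ξ) x₁ t h = innerState f δ A batch (r, s, u, ξ') x₁ t h
  | 0, _, _ => rfl
  | t + 1, h, hξ => by
    simp only [innerState, innerStep,
      innerState_congr batch x₁ t (Nat.le_of_succ_le h) fun j hj => hξ j (by omega),
      treeNoise_congr hξ]

/-- The change of the estimate of round `t₀` when `batch` is replaced by `batch'` while the query
points are those of the run on `batch`. -/
def estimateGap (batch batch' : (t : Fin T) → Fin (batchSize B₁ B₂ t) → Z) (t₀ : Fin T)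
    (x₁ : E d) (ω : RoundRandomness Seed d T B₁ B₂) : E d :=
  let S := innerState f δ A batch ω x₁ t₀ t₀.isLt.le
  let w := S.x + (ω.2.1 t₀ : ℝ) • A.next t₀ ω.1 S.gPriv
  if t₀.val = 0 then
    gradEst f δ w (batch t₀) (ω.2.2.1 t₀) - gradEst f δ w (batch' t₀) (ω.2.2.1 t₀)
  else
    diffEst f δ w S.w (batch t₀) (ω.2.2.1 t₀) - diffEst f δ w S.w (batch' t₀) (ω.2.2.1 t₀)

/-- The inequality `j < t₀` is strict because round `t₀` computes its estimate before its own noise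
is added. Shifts of coordinates from `t₀` on thus depend only on preceding coordinates, as adaptive
composition demands. -/
theorem estimateGap_congr (batch batch' : (t : Fin T) → Fin (batchSize B₁ B₂ t) → Z) (t₀ : Fin T)
    (x₁ : E d) {r : Seed} {s : Fin T → unitInterval}
    {u : (t : Fin T) → Fin (batchSize B₁ B₂ t) → Fin d → Sph d} {ξ ξ' : Fin T → E d}
    (h : ∀ j < t₀, ξ j = ξ' j) :
    estimateGap f δ A batch batch' t₀ x₁ (r, s, u, ξ) =
      estimateGap f δ A batch batch' t₀ x₁ (r, s, u, ξ') := by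
  simp only [estimateGap, innerState_congr f δ A batch x₁ t₀ t₀.isLt.le fun j hj => h j hj]

open Classical in
/-- The noise shift of round `i + 1`: nonzero only if the dyadic interval ending there contains the
round of the modified data point, and if the private estimates containing it are used at all. -/
def noiseShift (batch batch' : (t : Fin T) → Fin (batchSize B₁ B₂ t) → Z) (t₀ : Fin T)
    (x₁ : E d) (ω : RoundRandomness Seed d T B₁ B₂) (i : Fin T) : E d :=
  if i.val + 1 < T ∧ Covers (t₀.val + 1) (i.val + 1) then estimateGap f δ A batch batch' t₀ x₁ ω
  else 0

/-- The change of the noise that makes the run on `batch'` follow the run on `batch`. -/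
def roundShift (batch batch' : (t : Fin T) → Fin (batchSize B₁ B₂ t) → Z) (t₀ : Fin T)
    (x₁ : E d) (ω : RoundRandomness Seed d T B₁ B₂) : RoundRandomness Seed d T B₁ B₂ :=
  (ω.1, ω.2.1, ω.2.2.1, fun i => ω.2.2.2 i + noiseShift f δ A batch batch' t₀ x₁ ω i)

/-- Equal private estimates give equal decisions, hence equal query points; the gap in `g` is then
offset by the tree noise, which keeps the private estimates equal. At t = T this last equality may
fail, since noise T is not shifted, but no later decision reads that estimate. -/
theorem innerState_roundShift {batch batch' : (t : Fin T) → Fin (batchSize B₁ B₂ t) → Z}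
    {t₀ : Fin T} (hb : ∀ t, t ≠ t₀ → batch t = batch' t) (x₁ : E d)
    (ω : RoundRandomness Seed d T B₁ B₂) : ∀ (t : ℕ) (h : t ≤ T),
      let S := innerState f δ A batch ω x₁ t h
      let S' := innerState f δ A batch' (roundShift f δ A batch batch' t₀ x₁ ω) x₁ t h
      S'.x = S.x ∧ S'.w = S.w ∧ S'.wSum = S.wSum ∧ (t < T → S'.gPriv = S.gPriv) ∧
        S.g = S'.g + if t₀.val + 1 ≤ t then estimateGap f δ A batch batch' t₀ x₁ ω else 0
  | 0, _ => by simp [innerState]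
  | t + 1, h => by
    obtain ⟨hx, hw, hs, hp, hg⟩ := innerState_roundShift hb x₁ ω t (Nat.le_of_succ_le h)
    have hp := hp h
    set v := estimateGap f δ A batch batch' t₀ x₁ ω with hv
    have hw' : (innerState f δ A batch' (roundShift f δ A batch batch' t₀ x₁ ω) x₁ (t + 1) h).w =
        (innerState f δ A batch ω x₁ (t + 1) h).w := by
      simp only [innerState, innerStep, hx, hp]
      rfl
    have hg' : (innerState f δ A batch ω x₁ (t + 1) h).g =
        (innerState f δ A batch' (roundShift f δ A batch batch' t₀ x₁ ω) x₁ (t + 1) h).g +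
          if t₀.val + 1 ≤ t + 1 then v else 0 := by
      simp only [innerState, innerStep, hx, hp, hw]
      rcases eq_or_ne (⟨t, h⟩ : Fin T) t₀ with rfl | hne
      -- In round `t₀` both runs still have the same query points and the same `g`, so the gap is
      -- created here and is exactly `v`.
      · rw [if_neg (by simp), add_zero] at hg
        rw [if_pos le_rfl, hv, hg]
        simp only [estimateGap, roundShift]
        split_ifs with h0
        · abel
        · abel
      · have hne' : t ≠ t₀.val := fun h' => hne (Fin.ext h')
        rw [hb _ hne, hg]
        by_cases h0 : t = 0
        · rw [if_pos h0, if_pos h0, if_neg (by omega), add_zero]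
          rfl
        · have hle : t₀.val + 1 ≤ t + 1 ↔ t₀.val + 1 ≤ t := by omega
          simp only [if_neg h0, hle, roundShift]
          abel
    refine ⟨?_, hw', ?_, fun hT => ?_, hg'⟩
    · simp only [innerState, innerStep, hx, hp]
      rfl
    · simp only [innerState, innerStep, hx, hp, hs]
      rfl
    · have htree : treeNoise (roundShift f δ A batch batch' t₀ x₁ ω).2.2.2 (t + 1) =
          treeNoise ω.2.2.2 (t + 1) + if t₀.val + 1 ≤ t + 1 then v else 0 := by
        rw [← treeNoise_covers v (Nat.le_add_left 1 t₀.val) hT, ← treeNoise_add]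
        rfl
      have hsnoc : ∀ (b : (t : Fin T) → Fin (batchSize B₁ B₂ t) → Z)
          (η : RoundRandomness Seed d T B₁ B₂), (innerState f δ A b η x₁ (t + 1) h).gPriv =
            Fin.snoc (innerState f δ A b η x₁ t (Nat.le_of_succ_le h)).gPriv
              ((innerState f δ A b η x₁ (t + 1) h).g + treeNoise η.2.2.2 (t + 1)) :=
        fun _ _ => rfl
      rw [hsnoc, hsnoc, hp, htree, hg']
      congr 1
      abel

/-- Consecutive query points are at distance at most `2 * D`. -/
theorem norm_innerState_x_sub_w_le {D : ℝ} (hA : A.HasDomainBound D)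
    (batch : (t : Fin T) → Fin (batchSize B₁ B₂ t) → Z) (ω : RoundRandomness Seed d T B₁ B₂)
    (x₁ : E d) {t : ℕ} (ht : t ≠ 0) (h : t ≤ T) :
    ‖(innerState f δ A batch ω x₁ t h).x - (innerState f δ A batch ω x₁ t h).w‖ ≤ D := by
  obtain ⟨t, rfl⟩ := Nat.exists_eq_succ_of_ne_zero ht
  simp only [innerState, innerStep]
  set S := innerState f δ A batch ω x₁ t (Nat.le_of_succ_le h)
  have hs := (ω.2.1 ⟨t, h⟩).2
  rw [show ∀ (a b : E d) (r : ℝ), a + b - (a + r • b) = (1 - r) • b from fun a b r => by module,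
    norm_smul, Real.norm_of_nonneg (by linarith [hs.2])]
  exact (mul_le_of_le_one_left (norm_nonneg _) (by linarith [hs.1])).trans (hA _ _ _)

/-- The two kinds of rounds balance: 2dL/B₁ with B₁ ≥ TB₂/2, and 2(d/δ)L(2δ/T)/B₂ because
consecutive query points are within 2δ/T. -/
theorem norm_estimateGap_le {L : ℝ≥0} (hf : ∀ z, LipschitzWith L fun x => f x z)
    (hd : 1 ≤ d) (hT : 1 ≤ T) (hB₂ : 1 ≤ B₂) (hB : (B₁ : ℝ) ≥ T * B₂ / 2) {δ : ℝ} (hδ : 0 < δ)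
    (hA : A.HasDomainBound (δ / T)) {batch batch' : (t : Fin T) → Fin (batchSize B₁ B₂ t) → Z}
    {t₀ : Fin T} {i₀ : Fin (batchSize B₁ B₂ t₀)}
    (hb : ∀ i, i ≠ i₀ → batch t₀ i = batch' t₀ i) (x₁ : E d)
    (ω : RoundRandomness Seed d T B₁ B₂) :
    ‖estimateGap f δ A batch batch' t₀ x₁ ω‖ ≤ 4 * d * L / (B₂ * T) := by
  have hT' : (0 : ℝ) < T := by exact_mod_cast hT
  have hB' : (0 : ℝ) < B₂ := by exact_mod_cast hB₂
  rw [estimateGap]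
  set S := innerState f δ A batch ω x₁ t₀ t₀.isLt.le
  split_ifs with h0
  · refine (norm_gradEst_sub_le hd hf hδ _ hb _).trans ?_
    rw [batchSize, if_pos h0]
    calc 2 * (d * L) / (B₁ : ℝ) ≤ 2 * (d * L) / (T * B₂ / 2) := by gcongr
      _ = 4 * d * L / (B₂ * T) := by field_simp; ring
  · refine (norm_diffEst_sub_le hd hf hδ _ _ hb _).trans ?_
    rw [batchSize, if_neg h0]
    have hxw := norm_innerState_x_sub_w_le f δ A hA batch ω x₁ h0 t₀.isLt.le
    have hs := (ω.2.1 t₀).2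
    have hw : ‖S.x + (ω.2.1 t₀ : ℝ) • A.next t₀ ω.1 S.gPriv - S.w‖ ≤ δ / T + δ / T := by
      rw [add_sub_right_comm]
      refine norm_add_le_of_le hxw ?_
      rw [norm_smul, Real.norm_of_nonneg hs.1]
      exact (mul_le_of_le_one_left (norm_nonneg _) hs.2).trans (hA _ _ _)
    calc _ ≤ 2 * (d / δ * (L * (δ / T + δ / T))) / (B₂ : ℝ) := by gcongr
      _ = 4 * d * L / (B₂ * T) := by field_simp; ring

/-- The starting point of outer round `k + 1` only depends on the randomness of the first `k`
rounds. -/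
theorem outerStart_congr {K : ℕ} (batch : Fin K → (t : Fin T) → Fin (batchSize B₁ B₂ t) → Z)
    {ω ω' : Fin K → RoundRandomness Seed d T B₁ B₂} (x₁ : E d) : ∀ (k : ℕ) (h : k ≤ K),
      (∀ j : Fin K, j.val < k → ω j = ω' j) →
        outerStart f δ A batch ω x₁ k h = outerStart f δ A batch ω' x₁ k h
  | 0, _, _ => rfl
  | k + 1, h, hω => by
    simp only [outerStart, outerStart_congr batch x₁ k (Nat.le_of_succ_le h) fun j hj =>
      hω j (by omega), hω ⟨k, h⟩ (Nat.lt_succ_self k)]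

/-- `roundShift` in outer round `k₀ + 1`. -/
def outerShift {K : ℕ} (batch batch' : Fin K → (t : Fin T) → Fin (batchSize B₁ B₂ t) → Z)
    (k₀ : Fin K) (t₀ : Fin T) (x₁ : E d) (ω : Fin K → RoundRandomness Seed d T B₁ B₂) :
    Fin K → RoundRandomness Seed d T B₁ B₂ :=
  Function.update ω k₀ (roundShift f δ A (batch k₀) (batch' k₀) t₀
    (outerStart f δ A batch ω x₁ k₀ k₀.isLt.le) (ω k₀))

variable {K : ℕ}

theorem innerState_outerShift
    {batch batch' : Fin K → (t : Fin T) → Fin (batchSize B₁ B₂ t) → Z} {k₀ : Fin K} {t₀ : Fin T}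
    (hk : ∀ k, k ≠ k₀ → batch k = batch' k) (ht : ∀ t, t ≠ t₀ → batch k₀ t = batch' k₀ t)
    (x₁ : E d) (ω : Fin K → RoundRandomness Seed d T B₁ B₂) (k : Fin K)
    (hstart : outerStart f δ A batch' (outerShift f δ A batch batch' k₀ t₀ x₁ ω) x₁ k k.isLt.le =
      outerStart f δ A batch ω x₁ k k.isLt.le) :
    let S := innerState f δ A (batch k) (ω k) (outerStart f δ A batch ω x₁ k k.isLt.le) T le_rfl
    let S' := innerState f δ A (batch' k) (outerShift f δ A batch batch' k₀ t₀ x₁ ω k)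
      (outerStart f δ A batch' (outerShift f δ A batch batch' k₀ t₀ x₁ ω) x₁ k k.isLt.le) T le_rfl
    S'.x = S.x ∧ S'.wSum = S.wSum := by
  dsimp only
  rw [hstart]
  rcases eq_or_ne k k₀ with rfl | hne
  · have h := innerState_roundShift f δ A ht (outerStart f δ A batch ω x₁ k k.isLt.le) (ω k)
      T le_rfl
    rw [outerShift, Function.update_self]
    exact ⟨h.1, h.2.2.1⟩
  · rw [outerShift, Function.update_of_ne hne, hk k hne]
    exact ⟨rfl, rfl⟩

theorem outerStart_outerShift
    {batch batch' : Fin K → (t : Fin T) → Fin (batchSize B₁ B₂ t) → Z} {k₀ : Fin K} {t₀ : Fin T}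
    (hk : ∀ k, k ≠ k₀ → batch k = batch' k) (ht : ∀ t, t ≠ t₀ → batch k₀ t = batch' k₀ t)
    (x₁ : E d) (ω : Fin K → RoundRandomness Seed d T B₁ B₂) : ∀ (k : ℕ) (h : k ≤ K),
    outerStart f δ A batch' (outerShift f δ A batch batch' k₀ t₀ x₁ ω) x₁ k h =
      outerStart f δ A batch ω x₁ k h
  | 0, _ => rfl
  | k + 1, h => (innerState_outerShift f δ A hk ht x₁ ω ⟨k, h⟩
      (outerStart_outerShift hk ht x₁ ω k (Nat.le_of_succ_le h))).1

theorem roundAverage_outerShift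
    {batch batch' : Fin K → (t : Fin T) → Fin (batchSize B₁ B₂ t) → Z} {k₀ : Fin K} {t₀ : Fin T}
    (hk : ∀ k, k ≠ k₀ → batch k = batch' k) (ht : ∀ t, t ≠ t₀ → batch k₀ t = batch' k₀ t)
    (x₁ : E d) (ω : Fin K → RoundRandomness Seed d T B₁ B₂)
    (k : Fin K) :
    roundAverage f δ A batch' (outerShift f δ A batch batch' k₀ t₀ x₁ ω) x₁ k =
      roundAverage f δ A batch ω x₁ k := by
  rw [roundAverage, roundAverage, (innerState_outerShift f δ A hk ht x₁ ω k
    (outerStart_outerShift f δ A hk ht x₁ ω k k.isLt.le)).2]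

end Coupling


/-! ### Privacy -/

section Privacy

/-- A perturbation of one of several independent components that may depend on the others. -/
theorem DualBound.pi_update {X : Type*} [MeasurableSpace X] {α q : ℝ} (hq : α.HolderConjugate q)
    {K : ℕ} (k : Fin K) (ν : Measure X) [IsProbabilityMeasure ν] {C : ℝ≥0∞}
    {Ψ : (Fin K → X) → X → X} (hΨ : Measurable fun p : (Fin K → X) × X => Ψ p.1 p.2)
    (hdep : ∀ ω x, Ψ (Function.update ω k x) = Ψ ω) (h : ∀ ω, DualBound q C ν (Ψ ω)) :
    DualBound q C (Measure.pi fun _ => ν) fun ω => Function.update ω k (Ψ ω (ω k)) := by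
  obtain _ | n := K
  · exact k.elim0
  obtain ⟨x₀⟩ : Nonempty X := by
    by_contra hX
    rw [not_nonempty_iff] at hX
    exact IsProbabilityMeasure.ne_zero ν (Measure.eq_zero_of_isEmpty _)
  have hins : Measurable fun r : Fin n → X => (k.insertNth x₀ r : Fin (n + 1) → X) :=
    (MeasurableEquiv.piFinSuccAbove (fun _ => X) k).symm.measurable.comp
      (measurable_const.prodMk measurable_id)
  -- All other components come first and stay fixed at cost 1; component `k` is then perturbed
  -- conditionally on them.
  have hp := DualBound.prod hq.symm.pos (C₁ := 1) (ν₁ := Measure.pi fun _ : Fin n => ν)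
    (Φ := fun r => r) (Ψ := fun r => Ψ (k.insertNth x₀ r)) measurable_id
    (hΨ.comp ((hins.comp measurable_fst).prodMk measurable_snd)) (DualBound.id hq _) fun r => h _
  rw [one_mul] at hp
  refine DualBound.of_equiv
    ((MeasurableEquiv.piFinSuccAbove (fun _ => X) k).trans MeasurableEquiv.prodComm)
    (MeasurePreserving.trans (measurePreserving_piFinSuccAbove (fun _ => ν) k)
      Measure.measurePreserving_swap) ?_ hp
  intro ω
  have hswap : ∀ p : X × (Fin n → X), MeasurableEquiv.prodComm p = p.swap := fun _ => rfl
  have hω' : Ψ (Function.update ω k x₀) = Ψ ω := hdep ω x₀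
  simp [hswap, hω']

variable {Z Seed : Type*} [MeasurableSpace Seed] {d T B₁ B₂ : ℕ} {f : E d → Z → ℝ}
  (A : OCOAlgorithm Seed d) (δ : ℝ)

theorem measurable_estimateGap {Ω : Type*} [MeasurableSpace Ω]
    (hf : ∀ z, Measurable fun x => f x z)
    (batch batch' : (t : Fin T) → Fin (batchSize B₁ B₂ t) → Z) (t₀ : Fin T)
    {W : Ω → RoundRandomness Seed d T B₁ B₂} (hW : Measurable W) {X : Ω → E d}
    (hX : Measurable X) :
    Measurable fun a => estimateGap f δ A batch batch' t₀ (X a) (W a) := by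
  have h := measurableState_innerState A δ hf batch hW hX t₀ t₀.isLt.le
  have hΔ := (A.measurable_next t₀).comp (hW.fst.prodMk h.gPriv)
  have hs : Measurable fun a => ((W a).2.1 t₀ : ℝ) := by fun_prop
  have hu : Measurable fun a => (W a).2.2.1 t₀ := by fun_prop
  have hw := h.x.add (hs.smul hΔ)
  simp only [estimateGap]
  split_ifs
  · exact (measurable_gradEst hf δ _ hw hu).sub (measurable_gradEst hf δ _ hw hu)
  · exact (measurable_diffEst hf δ _ hw h.w hu).sub (measurable_diffEst hf δ _ hw h.w hu)

theorem measurable_noiseShift {Ω : Type*} [MeasurableSpace Ω]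
    (hf : ∀ z, Measurable fun x => f x z)
    (batch batch' : (t : Fin T) → Fin (batchSize B₁ B₂ t) → Z) (t₀ : Fin T)
    {W : Ω → RoundRandomness Seed d T B₁ B₂} (hW : Measurable W) {X : Ω → E d}
    (hX : Measurable X) (i : Fin T) :
    Measurable fun a => noiseShift f δ A batch batch' t₀ (X a) (W a) i := by
  unfold noiseShift
  split_ifs
  · exact measurable_estimateGap A δ hf batch batch' t₀ hW hX
  · exact measurable_const

theorem measurable_roundShift {Ω : Type*} [MeasurableSpace Ω]
    (hf : ∀ z, Measurable fun x => f x z)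
    (batch batch' : (t : Fin T) → Fin (batchSize B₁ B₂ t) → Z) (t₀ : Fin T)
    {W : Ω → RoundRandomness Seed d T B₁ B₂} (hW : Measurable W) {X : Ω → E d}
    (hX : Measurable X) :
    Measurable fun a => roundShift f δ A batch batch' t₀ (X a) (W a) := by
  refine hW.fst.prodMk (hW.snd.fst.prodMk (hW.snd.snd.fst.prodMk
    (measurable_pi_lambda _ fun i => ?_)))
  exact ((measurable_pi_apply i).comp hW.snd.snd.snd).add
    (measurable_noiseShift A δ hf batch batch' t₀ hW hX i)

/-- The total cost of moving the noise of all dyadic intervals containing a round. -/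
theorem card_covers_mul_le {s : ℕ} (hs : 1 ≤ s) {S ρ σ : ℝ} (hρ : 0 < ρ)
    (hσ : σ = Real.sqrt (2 * Real.log T) * S / ρ) :
    open Classical in
    ((Finset.univ.filter fun i : Fin T => i.val + 1 < T ∧ Covers s (i.val + 1)).card : ℝ) *
      (S ^ 2 / σ ^ 2) ≤ ρ ^ 2 := by
  classical
  -- For T ≤ 1 no interval ends before T, so nothing is shifted; this also covers ln T = 0.
  rcases lt_or_ge T 2 with hT | hT
  · rw [Finset.filter_false_of_mem fun i _ h => by omega]
    simp
    positivity
  rcases eq_or_ne S 0 with rfl | hS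
  · simp
    positivity
  have hlog : 0 < Real.log T := Real.log_pos (by exact_mod_cast hT)
  have hcard : ((Finset.univ.filter fun i : Fin T => i.val + 1 < T ∧ Covers s (i.val + 1)).card : ℝ)
      ≤ 2 * Real.log T :=
    (Nat.cast_le.2 (card_covers_le s T hs)).trans (clog_two_le_two_mul_log hT)
  have hσ2 : σ ^ 2 = 2 * Real.log T * S ^ 2 / ρ ^ 2 := by
    rw [hσ, div_pow, mul_pow, Real.sq_sqrt (by positivity)]
  calc _ ≤ 2 * Real.log T * (S ^ 2 / σ ^ 2) := by gcongr
    _ = ρ ^ 2 := by rw [hσ2]; field_simp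

/-- Given the other randomness, this is adaptive composition over the noise vectors, with the factor
1 at every interval that does not contain the modified round or ends at T. -/
theorem dualBound_noiseShift {α q : ℝ} (hq : α.HolderConjugate q)
    (hf : ∀ z, Measurable fun x => f x z)
    (batch batch' : (t : Fin T) → Fin (batchSize B₁ B₂ t) → Z) (t₀ : Fin T) {S ρ σ : ℝ}
    (hρ : 0 < ρ) (hσ : σ = Real.sqrt (2 * Real.log T) * S / ρ) (x₁ : E d)
    (hS : ∀ ω, ‖estimateGap f δ A batch batch' t₀ x₁ ω‖ ≤ S)
    (r : Seed) (s : Fin T → unitInterval)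
    (u : (t : Fin T) → Fin (batchSize B₁ B₂ t) → Fin d → Sph d) :
    DualBound q (ENNReal.ofReal (Real.exp ((α - 1) / 2 * ρ ^ 2)))
      (Measure.pi fun _ : Fin T => gaussianNoise d σ)
      fun ξ i => ξ i + noiseShift f δ A batch batch' t₀ x₁ (r, s, u, ξ) i := by
  classical
  have hα : 0 < α - 1 := hq.sub_one_pos
  let P : Fin T → Prop := fun i => i.val + 1 < T ∧ Covers (t₀.val + 1) (i.val + 1)
  have hpos : ∀ i ω, P i → noiseShift f δ A batch batch' t₀ x₁ ω i =
      estimateGap f δ A batch batch' t₀ x₁ ω := fun i ω hi => if_pos hi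
  have hneg : ∀ i ω, ¬ P i → noiseShift f δ A batch batch' t₀ x₁ ω i = 0 :=
    fun i ω hi => if_neg hi
  have h := DualBound.pi_add hq (fun _ : Fin T => gaussianNoise d σ)
    (fun i => ENNReal.ofReal (Real.exp (if P i then (α - 1) / 2 * (S ^ 2 / σ ^ 2) else 0)))
    (fun i ξ => noiseShift f δ A batch batch' t₀ x₁ (r, s, u, ξ) i)
    (fun i => measurable_noiseShift A δ hf batch batch' t₀ (by fun_prop) measurable_const i)
    (fun i ξ ξ' hξ => ?_) fun i ξ => ?_
  · refine h.mono ?_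
    rw [← ENNReal.ofReal_prod_of_nonneg fun i _ => (Real.exp_pos _).le, ← Real.exp_sum]
    refine ENNReal.ofReal_le_ofReal (Real.exp_le_exp.2 ?_)
    rw [← Finset.sum_filter, Finset.sum_const, nsmul_eq_mul, mul_left_comm]
    exact mul_le_mul_of_nonneg_left (card_covers_mul_le (Nat.le_add_left 1 _) hρ hσ)
      (by positivity)
  · by_cases hi : P i
    · simp only [hpos i _ hi]
      have hle : t₀.val ≤ i.val := Nat.le_of_succ_le_succ hi.2.le
      exact estimateGap_congr f δ A batch batch' t₀ x₁ fun j hj =>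
        hξ j (lt_of_lt_of_le hj hle)
    · simp only [hneg i _ hi]
  · by_cases hi : P i
    · simp only [hpos i _ hi, if_pos hi]
      have hn := hS (r, s, u, ξ)
      -- A shifted coordinate exists only if T ≥ 2, so ln T > 0 and σ = 0 forces S = 0.
      refine (dualBound_gaussianNoise hq fun h0 => ?_).mono ?_
      · have hlog : 0 < Real.log T := Real.log_pos (by exact_mod_cast (by omega : 1 < T))
        have h1 : Real.sqrt (2 * Real.log T) ≠ 0 := by positivity
        have hS0 : S = 0 := by
          rw [hσ, div_eq_zero_iff, mul_eq_zero] at h0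
          rcases h0 with (h0 | h0) | h0
          exacts [absurd h0 h1, h0, absurd h0 hρ.ne']
        exact norm_le_zero_iff.1 (hS0 ▸ hn)
      · gcongr
    · simp only [hneg i _ hi, if_neg hi, add_zero, Real.exp_zero, ENNReal.ofReal_one]
      exact DualBound.id hq _

theorem dualBound_roundShift (hd : 1 ≤ d) {α q : ℝ} (hq : α.HolderConjugate q)
    (hf : ∀ z, Measurable fun x => f x z)
    (batch batch' : (t : Fin T) → Fin (batchSize B₁ B₂ t) → Z) (t₀ : Fin T) {S ρ σ : ℝ}
    (hρ : 0 < ρ) (hσ : σ = Real.sqrt (2 * Real.log T) * S / ρ) (x₁ : E d)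
    (hS : ∀ ω, ‖estimateGap f δ A batch batch' t₀ x₁ ω‖ ≤ S) :
    DualBound q (ENNReal.ofReal (Real.exp ((α - 1) / 2 * ρ ^ 2)))
      (roundLaw A B₁ B₂ fun _ => σ) (roundShift f δ A batch batch' t₀ x₁) := by
  have := isProbabilityMeasure_unifSphere hd
  have := A.isProbabilityMeasure_seedLaw
  have hm := measurable_roundShift A δ hf batch batch' t₀ measurable_id
    (measurable_const (a := x₁))
  have h := DualBound.prod hq.symm.pos (measurable_id (α := Seed))
    (Ψ := fun r p => (roundShift f δ A batch batch' t₀ x₁ (r, p)).2) hm.snd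
    (DualBound.id hq A.seedLaw) fun r =>
    DualBound.prod hq.symm.pos (measurable_id (α := Fin T → unitInterval))
      (Ψ := fun s p => (roundShift f δ A batch batch' t₀ x₁ (r, s, p)).2.2)
      (hm.snd.snd.comp (measurable_const.prodMk measurable_id))
      (DualBound.id hq (Measure.pi fun _ : Fin T => (volume : Measure unitInterval))) fun s =>
      DualBound.prod hq.symm.pos
        (measurable_id (α := (t : Fin T) → Fin (batchSize B₁ B₂ t) → Fin d → Sph d))
        (Ψ := fun u ξ => (roundShift f δ A batch batch' t₀ x₁ (r, s, u, ξ)).2.2.2)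
        (hm.snd.snd.snd.comp
          (measurable_const.prodMk (measurable_const.prodMk measurable_id)))
        (DualBound.id hq (Measure.pi fun t : Fin T =>
          Measure.pi fun _ : Fin (batchSize B₁ B₂ t) => Measure.pi fun _ : Fin d => unifSphere d))
        fun u => dualBound_noiseShift A δ hq hf batch batch' t₀ hρ hσ x₁ hS r s u
  rw [one_mul, one_mul, one_mul] at h
  exact h

/-- The output laws on neighboring datasets, in the dual formulation. -/
theorem lintegral_outputLaw_le {K M : ℕ} (hd : 1 ≤ d) (hK : 1 ≤ K) {α q : ℝ}
    (hq : α.HolderConjugate q) (hf : ∀ z, Measurable fun x => f x z)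
    (part : BatchIdx K T B₁ B₂ ≃ Fin M) (x₁ : E d) {D D' : Fin M → Z} {k₀ : Fin K} {t₀ : Fin T}
    (hk : ∀ k, k ≠ k₀ → ∀ t i, D (part ⟨k, t, i⟩) = D' (part ⟨k, t, i⟩))
    (ht : ∀ t, t ≠ t₀ → ∀ i, D (part ⟨k₀, t, i⟩) = D' (part ⟨k₀, t, i⟩)) {S ρ σ : ℝ}
    (hρ : 0 < ρ) (hσ : σ = Real.sqrt (2 * Real.log T) * S / ρ)
    (hS : ∀ x ω, ‖estimateGap f δ A (fun t i => D (part ⟨k₀, t, i⟩))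
      (fun t i => D' (part ⟨k₀, t, i⟩)) t₀ x ω‖ ≤ S) (g : E d → ℝ≥0∞) (hg : Measurable g) :
    ∫⁻ x, g x ∂(outputLaw f δ A part (fun _ => σ) x₁ D) ≤
      ENNReal.ofReal (Real.exp ((α - 1) / 2 * ρ ^ 2)) *
        (∫⁻ x, g x ^ q ∂(outputLaw f δ A part (fun _ => σ) x₁ D')) ^ (1 / q) := by
  have := isProbabilityMeasure_roundLaw (B₁ := B₁) (B₂ := B₂) A hd fun _ : Fin T => σ
  have : Nonempty (Fin K) := ⟨⟨0, hK⟩⟩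
  have : IsProbabilityMeasure (uniformOn (Set.univ : Set (Fin K))) :=
    isProbabilityMeasure_uniformOn Set.finite_univ Set.univ_nonempty
  set bat : (Fin M → Z) → (k : Fin K) → (t : Fin T) → Fin (batchSize B₁ B₂ t) → Z :=
    fun D k t i => D (part ⟨k, t, i⟩) with hbat
  have hF : ∀ D, Measurable fun p : (Fin K → RoundRandomness Seed d T B₁ B₂) × Fin K =>
      roundAverage f δ A (bat D) p.1 x₁ p.2 := fun D => measurable_roundAverage A δ hf (bat D) x₁
  have hΨ : Measurable fun p : (Fin K → RoundRandomness Seed d T B₁ B₂) ×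
      RoundRandomness Seed d T B₁ B₂ => roundShift f δ A (bat D k₀) (bat D' k₀) t₀
        (outerStart f δ A (bat D) p.1 x₁ k₀ k₀.isLt.le) p.2 :=
    measurable_roundShift A δ hf (bat D k₀) (bat D' k₀) t₀ measurable_snd
      ((measurable_outerStart A δ hf (bat D) x₁ k₀ k₀.isLt.le).comp measurable_fst)
  have hdep : ∀ (ω : Fin K → RoundRandomness Seed d T B₁ B₂) x,
      outerStart f δ A (bat D) (Function.update ω k₀ x) x₁ k₀ k₀.isLt.le =
        outerStart f δ A (bat D) ω x₁ k₀ k₀.isLt.le := fun ω x =>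
    outerStart_congr f δ A (bat D) x₁ k₀ k₀.isLt.le fun j hj =>
      Function.update_of_ne (Fin.ne_of_lt hj) x ω
  have hpi : DualBound q (ENNReal.ofReal (Real.exp ((α - 1) / 2 * ρ ^ 2)))
      (Measure.pi fun _ : Fin K => roundLaw A B₁ B₂ fun _ => σ)
      (outerShift f δ A (bat D) (bat D') k₀ t₀ x₁) :=
    DualBound.pi_update hq k₀ (roundLaw A B₁ B₂ fun _ => σ)
      (Ψ := fun ω => roundShift f δ A (bat D k₀) (bat D' k₀) t₀
        (outerStart f δ A (bat D) ω x₁ k₀ k₀.isLt.le)) hΨ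
      (fun ω x => by rw [hdep])
      fun ω => dualBound_roundShift A δ hd hq hf (bat D k₀) (bat D' k₀) t₀ hρ hσ _ (hS _)
  have hshift : Measurable (outerShift f δ A (bat D) (bat D') k₀ t₀ x₁) := by
    refine measurable_pi_lambda _ fun k => ?_
    rcases eq_or_ne k k₀ with rfl | hne
    · simp only [outerShift, Function.update_self]
      exact hΨ.comp (measurable_id.prodMk (measurable_pi_apply k))
    · simp only [outerShift, Function.update_of_ne hne]
      exact measurable_pi_apply k
  -- Post-processing: the bound on the randomness is tested against `g` composed with the run on
  -- `D'`. By the coupling, that run on shifted randomness returns the output of the run on `D`.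
  have h := DualBound.prod hq.symm.pos (Ψ := fun _ k => k) hshift measurable_snd hpi
    (fun _ => DualBound.id hq (uniformOn (Set.univ : Set (Fin K))))
    (fun p => g (roundAverage f δ A (bat D') p.1 x₁ p.2)) (hg.comp (hF D'))
  rw [mul_one] at h
  rw [outputLaw, outputLaw, lintegral_map hg (hF D), lintegral_map (hg.pow_const q) (hF D')]
  refine le_of_eq_of_le (lintegral_congr fun p => congrArg g ?_) h
  exact (roundAverage_outerShift f δ A
    (fun k hk' => funext fun t => funext fun i => hk k hk' t i)
    (fun t ht' => funext fun i => ht t ht' i) x₁ p.1 p.2).symm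

end Privacy

end PrivateO2NC

end

/-! ### The privacy guarantee -/

theorem mainTheorem3 {Z Seed : Type*} [MeasurableSpace Seed] (d K T B₁ B₂ : ℕ)
    (hd : 1 ≤ d) (hK : 1 ≤ K) (hT : 1 ≤ T) (hB₂ : 1 ≤ B₂)
    (hB : (B₁ : ℝ) ≥ T * B₂ / 2)
    (f : PrivateO2NC.E d → Z → ℝ) (L : ℝ≥0) (hf : ∀ z, LipschitzWith L fun x => f x z)
    (δ : ℝ) (hδ : 0 < δ)
    (A : PrivateO2NC.OCOAlgorithm Seed d) (hA : A.HasDomainBound (δ / T))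
    (part : PrivateO2NC.BatchIdx K T B₁ B₂ ≃ Fin (K * (B₁ + B₂ * (T - 1))))
    (x₁ : PrivateO2NC.E d) (α ρ : ℝ) (hα : 1 < α) (hρ : 0 < ρ) (σ : ℝ)
    (hσ : σ = Real.sqrt (2 * Real.log T) * (4 * d * L) / (B₂ * T * ρ)) :
    (∀ D, IsProbabilityMeasure (PrivateO2NC.outputLaw f δ A part (fun _ => σ) x₁ D)) ∧
      PrivateO2NC.IsRDP α (α * ρ ^ 2 / 2)
        (PrivateO2NC.outputLaw f δ A part (fun _ => σ) x₁) := by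
  have hm : ∀ z, Measurable fun x => f x z := fun z => (hf z).continuous.measurable
  have hprob := PrivateO2NC.isProbabilityMeasure_outputLaw A δ hd hK hm part (fun _ => σ) x₁
  refine ⟨hprob, ?_⟩
  rintro D D' ⟨p, hp⟩
  -- The modified position belongs to exactly one batch, so only one estimate is affected directly.
  obtain ⟨⟨k₀, t₀, i₀⟩, rfl⟩ := part.surjective p
  have := hprob D
  have := hprob D'
  have hq : α.HolderConjugate (Real.conjExponent α) := .conjExponent hα
  have hdiff : ∀ k t i, (⟨k, t, i⟩ : PrivateO2NC.BatchIdx K T B₁ B₂) ≠ ⟨k₀, t₀, i₀⟩ →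
      D (part ⟨k, t, i⟩) = D' (part ⟨k, t, i⟩) := fun k t i h => hp _ (part.injective.ne h)
  refine PrivateO2NC.renyiDiv_le_of_dual hq fun g hg => ?_
  have hα0 : α ≠ 0 := hq.pos.ne'
  rw [show (α - 1) / α * (α * ρ ^ 2 / 2) = (α - 1) / 2 * ρ ^ 2 by field_simp]
  refine PrivateO2NC.lintegral_outputLaw_le A δ hd hK hq hm part x₁ (k₀ := k₀) (t₀ := t₀)
    (fun k hk t i => hdiff k t i fun h => hk (congrArg Sigma.fst h))
    (fun t ht i => hdiff k₀ t i fun h => ht ?_) hρ (S := 4 * d * L / (B₂ * T))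
    (by rw [hσ, div_eq_div_iff (by positivity) (by positivity)]; field_simp)
    (fun x ω => PrivateO2NC.norm_estimateGap_le f A hf hd hT hB₂ hB hδ hA (i₀ := i₀)
      (fun i hi => hdiff k₀ t₀ i fun h => hi ?_) x ω) g hg
  · simp only [Sigma.mk.injEq, heq_eq_eq, true_and] at h
    exact h.1
  · simpa using h
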